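/- Let $G$ be a finitely generated nilpotent group with a fixed finite generating set $\mathcal F$, and let $H\le G$ be a subgroup. Let $G_1=G$, $G_{j+1}=[G,G_j]$ be the lower central series, let $d_j^G$ be the (torsion-free) rank of the finitely generated abelian group $G_j/G_{j+1}$, and let $d_j^{H;G}$ be the rank of the image of $H\cap G_j$ in $G_j/G_{j+1}$. Put $D_G=\sum_j j\,d_j^G$ and $D_{H;G}=\sum_j j\,d_j^{H;G}$ (finite sums). Let $B_n^G(e)$ be the closed ball of radius $n$ about the identity for the graph metric on $G$ in which each $g$ is joined by an edge to every $fg$, $f\in\mathcal F$, and let $B_n^{G/H}(e)$ be the closed ball of radius $n$ about the coset $H$ in the Schreier graph on the set $G/H$ of left cosets, in which each $gH$ is joined by an edge to every $fgH$, $f\in\mathcal F$. For sequences of positive numbers write $a_n\asymp b_n$ if there is a constant $C>0$ with $1/C\le a_n/b_n\le C$ for all sufficiently large $n$. Then $$\lim_{n\to\infty}\frac{\log \#(B_n^G(e)\cap H)}{\log n}=D_{H;G},\qquad \lim_{n\to\infty}\frac{\log \# B_n^{G/H}(e)}{\log n}=\sum_j j\,(d_j^G-d_j^{H;G})=D_G-D_{H;G}.$$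 Moreover, $$\#(B_n^G(e)\cap H)\asymp n^{D_{H;G}}\qquad\text{and}\qquad \# B_n^{G/H}(e)\asymp n^{D_G-D_{H;G}}.$$ -/

import Mathlib

open Filter Topology

namespace NilGrowth

section Growth

/-- The Schreier graph of an action of `G` on `X` with respect to `F ⊆ G`: distinct `x`, `y` are
adjacent iff `y = f • x` or `x = f • y` for some `f ∈ F`. For `X = G` with left multiplication it
is the (left) Cayley graph, in which `g` is joined to every `f * g`; for `X = G ⧸ H` it is the
Schreier graph of `H`, in which `gH` is joined to every `fgH`. -/
def schreierGraph {G : Type*} [Group G] (F : Set G) (X : Type*) [MulAction G X] :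
    SimpleGraph X :=
  SimpleGraph.fromRel fun x y => ∃ f ∈ F, f • x = y

/-- The closed ball of radius `n` around `x` in the graph metric of the Schreier graph (points in
other connected components are at distance `⊤`). -/
def ball {G : Type*} [Group G] (F : Set G) {X : Type*} [MulAction G X] (x : X) (n : ℕ) : Set X :=
  {y | (schreierGraph F X).edist x y ≤ n}

/-- The relative growth function of `H` in `G`: the number of elements of `H` in the ball
of radius `n` of `G` around `1`. -/
noncomputable def relGrowth {G : Type*} [Group G] (F : Set G) (H : Subgroup G) (n : ℕ) : ℕ :=
  (ball F (1 : G) n ∩ (H : Set G)).ncard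

/-- The growth function of the Schreier graph `G ⧸ H`: the number of vertices in the ball of
radius `n` around the coset of `1`. -/
noncomputable def cosetGrowth {G : Type*} [Group G] (F : Set G) (H : Subgroup G) (n : ℕ) : ℕ :=
  (ball F ((1 : G) : G ⧸ H) n).ncard

/-- `V` has polynomial growth of degree `d`: `log V(n) / log n → d`. -/
def HasGrowthDegree (V : ℕ → ℕ) (d : ℝ) : Prop :=
  Tendsto (fun n : ℕ => Real.log (V n) / Real.log n) atTop (𝓝 d)

/-- `a ≍ b` for sequences of (eventually) positive numbers. -/
def Comparable (a b : ℕ → ℝ) : Prop :=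
  ∃ C : ℝ, 0 < C ∧ ∀ᶠ n in atTop, 1 / C ≤ a n / b n ∧ a n / b n ≤ C

end Growth

section LowerCentral

variable (G : Type*) [Group G]

/-- The lower central series indexed from one: `G₁ = G`, `G_{j+1} = [G, G_j]`.
(Only `j ≥ 1` is used; the value at `j = 0` is `G`.) -/
def lcs (j : ℕ) : Subgroup G := (⊤ : Subgroup G).lowerCentralSeries (j - 1)

theorem lcs_one : lcs G 1 = ⊤ := rfl

theorem lcs_succ (j : ℕ) (hj : 1 ≤ j) : lcs G (j + 1) = ⁅(⊤ : Subgroup G), lcs G j⁆ := by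
  obtain ⟨k, rfl⟩ := Nat.exists_eq_add_of_le' hj
  exact Subgroup.commutator_comm _ _

instance lcs_normal (j : ℕ) : (lcs G j).Normal := by
  unfold lcs; infer_instance

/-- The quotient `G_j / G_{j+1}`. -/
abbrev LcsQuot (j : ℕ) : Type _ := lcs G j ⧸ (lcs G (j + 1)).subgroupOf (lcs G j)

/-- `G_j / G_{j+1}` is abelian. -/
instance lcsQuotCommGroup (j : ℕ) : CommGroup (LcsQuot G j) :=
  { (inferInstance : Group (LcsQuot G j)) with
    mul_comm := by
      intro a b
      induction a using QuotientGroup.induction_on with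
      | H x =>
        induction b using QuotientGroup.induction_on with
        | H y =>
          rw [← QuotientGroup.mk_mul, ← QuotientGroup.mk_mul, QuotientGroup.eq,
            Subgroup.mem_subgroupOf]
          rcases Nat.eq_zero_or_pos j with rfl | hj
          · exact Subgroup.mem_top _
          · rw [lcs_succ G j hj]
            have h := Subgroup.commutator_mem_commutator
              (Subgroup.mem_top ((y : G)⁻¹)) (inv_mem x.2)
            simpa [commutatorElement_def, mul_assoc] using h }

/-- The quotient map `φ_j : G_j → G_j / G_{j+1}`. -/
def lcsMap (j : ℕ) : lcs G j →* LcsQuot G j :=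
  QuotientGroup.mk' ((lcs G (j + 1)).subgroupOf (lcs G j))

/-- The rank `d_j^G` of the abelian group `G_j / G_{j+1}`. -/
noncomputable def lcsRank (j : ℕ) : ℕ := Module.finrank ℤ (Additive (LcsQuot G j))

variable {G}

/-- The rank `d_j^{H;G}` of the image of `H ∩ G_j` in `G_j / G_{j+1}`. -/
noncomputable def relRank (H : Subgroup G) (j : ℕ) : ℕ :=
  Module.finrank ℤ (Additive ((H.subgroupOf (lcs G j)).map (lcsMap G j)))

variable (G)

/-- `D_G = ∑_j j d_j^G`; for `j` larger than the nilpotency class `G_j` is trivial. -/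
noncomputable def degree [Group.IsNilpotent G] : ℕ :=
  ∑ j ∈ Finset.Icc 1 (Group.nilpotencyClass G), j * lcsRank G j

variable {G}

/-- `D_{H;G} = ∑_j j d_j^{H;G}`. -/
noncomputable def relDegree [Group.IsNilpotent G] (H : Subgroup G) : ℕ :=
  ∑ j ∈ Finset.Icc 1 (Group.nilpotencyClass G), j * relRank H j

/-- `∑_j j (d_j^G - d_j^{H;G})`, with subtraction in `ℤ`. -/
noncomputable def cosetDegree [Group.IsNilpotent G] (H : Subgroup G) : ℤ :=
  ∑ j ∈ Finset.Icc 1 (Group.nilpotencyClass G), (j : ℤ) * ((lcsRank G j : ℤ) - relRank H j)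

end LowerCentral

end NilGrowth

namespace NilGrowth

open scoped commutatorElement Pointwise

/-! ### Commutators along the lower central series. -/

section LowerCentralFacts

variable {G : Type*} [Group G]

/-! At scale `n`, let an `i`-fold commutator of generators be a letter of cost `n ^ (-i)`. A word of
length `n` in the generators then has cost at most 1. Conversely, bounded cost forces word length
`O(n)` (`exists_mem_wordBall_of_rep`): commutators are bilinear to leading order, so the `k`-th
power of a commutator of weight `i`, with `k ≤ n ^ i`, is a word of length `O(n)` modulo `G_{i+1}`
(`exists_wordBall_eq_pow`). Up to constants, balls may therefore be replaced by sets of bounded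
cost.

Cost is compatible with the lower central series: an element of `G_j` of bounded cost has bounded
cost in letters of weight at least `j` alone (`exists_rep_letters_of_mem_lcs`). Letters of weight
`j` are collected to the left one at a time. Moving `t ^ k`, with `k = O(n ^ j)`, past a letter of
weight `i` creates only heavier letters, of total cost `O(n ^ (-i))` (`exists_rep_conj_zpow`), so
the cost stays bounded. If the product lies in `G_{j+1}`, the collected power can be rewritten in
the remaining letters.

Counting `H` now goes layer by layer. The image of bounded-cost elements of `H ∩ G_j` in `G_j /
G_{j+1}` has `O(n ^ (j * relRank H j))` elements, and each fibre is a translate of a set of bounded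
cost in `H ∩ G_{j+1}`; multiplying gives the upper bound `exists_ncard_repSet_le`. Products of
powers of independent elements give the lower bound `exists_le_ncard_repSet`. For cosets, the growth
of `G` (the case `H = ⊤`) is compared with the product of the growths of `H` and `G ⧸ H`. -/

theorem lcs_antitone {i j : ℕ} (h : i ≤ j) : lcs G j ≤ lcs G i :=
  Subgroup.lowerCentralSeries_antitone _ (by omega)

/-- The three subgroups lemma modulo `N`, obtained from the version with trivial commutators in the
quotient `G ⧸ N`. -/
theorem commutator_le_of_rotate {H₁ H₂ H₃ N : Subgroup G} [N.Normal]
    (h1 : ⁅⁅H₂, H₃⁆, H₁⁆ ≤ N) (h2 : ⁅⁅H₃, H₁⁆, H₂⁆ ≤ N) : ⁅⁅H₁, H₂⁆, H₃⁆ ≤ N := by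
  have key : ∀ K : Subgroup G, K ≤ N ↔ K.map (QuotientGroup.mk' N) = ⊥ := fun K => by
    rw [Subgroup.map_eq_bot_iff, QuotientGroup.ker_mk']
  rw [key] at *
  simp only [Subgroup.map_commutator] at *
  exact Subgroup.commutator_commutator_eq_bot_of_rotate h1 h2

/-- Induction on `i`: writing `G_{i+1} = [G, G_i]`, the three subgroups lemma reduces to two
commutators controlled by the case `i`. -/
theorem commutator_lcs_le (i j : ℕ) (hi : 1 ≤ i) (hj : 1 ≤ j) :
    ⁅lcs G i, lcs G j⁆ ≤ lcs G (i + j) := by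
  induction i, hi using Nat.le_induction generalizing j with
  | base => rw [lcs_one, add_comm, lcs_succ G j hj]
  | succ i hi ih =>
    rw [lcs_succ G i hi]
    refine commutator_le_of_rotate ?_ ?_
    · rw [Subgroup.commutator_comm, show i + 1 + j = (i + j) + 1 by omega,
        lcs_succ G (i + j) (by omega)]
      exact Subgroup.commutator_mono le_rfl (ih j hj)
    · rw [Subgroup.commutator_comm _ ⊤, ← lcs_succ G j hj, Subgroup.commutator_comm,
        show i + 1 + j = i + (j + 1) by omega]
      exact ih (j + 1) (by omega)

theorem commutator_mem_lcs {i j : ℕ} (hi : 1 ≤ i) (hj : 1 ≤ j) {g t : G} (hg : g ∈ lcs G i)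
    (ht : t ∈ lcs G j) : ⁅g, t⁆ ∈ lcs G (i + j) :=
  commutator_lcs_le i j hi hj (Subgroup.commutator_mem_commutator hg ht)

theorem commute_mk_of_mem_lcs {j : ℕ} (hj : 1 ≤ j) {z : G} (hz : z ∈ lcs G j) (g : G) :
    Commute (z : G ⧸ lcs G (j + 1)) (g : G ⧸ lcs G (j + 1)) := by
  have h := commutator_mem_lcs hj le_rfl hz (show g ∈ lcs G 1 from Subgroup.mem_top g)
  rw [← commutatorElement_eq_one_iff_commute]
  exact (QuotientGroup.eq_one_iff _).2 h

theorem exists_lcs_add_eq_bot [Group.IsNilpotent G] (j : ℕ) : ∃ d, lcs G (j + d) = ⊥ := by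
  refine ⟨Group.nilpotencyClass G + 1, ?_⟩
  rw [lcs, Subgroup.lowerCentralSeries_eq_bot_iff_nilpotencyClass_le]
  omega

end LowerCentralFacts

/-! ### Generators of the lower central series. -/

section Generators

variable {G : Type*} [Group G]

/-- Left-normed iterated commutators of `k + 1` elements of `F`. -/
def iterComm (F : Set G) : ℕ → Set G
  | 0 => F
  | k + 1 => Set.image2 (fun s u => ⁅s, u⁆) F (iterComm F k)

/-- The nontrivial `j`-fold commutators of elements of `F`; they generate `G_j` modulo
`G_{j+1}`. -/
def gens (F : Set G) (j : ℕ) : Set G := iterComm F (j - 1) \ {1}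

theorem iterComm_finite {F : Set G} (hF : F.Finite) (k : ℕ) : (iterComm F k).Finite := by
  induction k with
  | zero => exact hF
  | succ k ih => exact hF.image2 _ ih

theorem iterComm_subset (F : Set G) (k : ℕ) : iterComm F k ⊆ lcs G (k + 1) := by
  induction k with
  | zero => exact fun _ _ => Subgroup.mem_top _
  | succ k ih =>
    rintro _ ⟨s, -, u, hu, rfl⟩
    rw [lcs_succ G (k + 1) (by omega)]
    exact Subgroup.commutator_mem_commutator (Subgroup.mem_top s) (ih hu)

theorem gens_subset (F : Set G) {j : ℕ} (hj : 1 ≤ j) : gens F j ⊆ lcs G j := by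
  intro x hx
  have h := iterComm_subset F (j - 1) hx.1
  rwa [Nat.sub_add_cancel hj] at h

/-- In the quotient by the right-hand side `M` for `k + 1`, each commutator in `iterComm F k`
commutes with the generators `F`, hence is central. So `G_{k+1}` becomes central there, which says
`[G, G_{k+1}] ≤ M`. -/
theorem lcs_le_closure_iterComm {F : Set G} (hF : Subgroup.closure F = ⊤) (k : ℕ) :
    lcs G (k + 1) ≤ Subgroup.closure (iterComm F k) ⊔ lcs G (k + 2) := by
  induction k with
  | zero => rw [iterComm, hF]; simp
  | succ k ih =>
    set M := Subgroup.closure (iterComm F (k + 1)) ⊔ lcs G (k + 1 + 2) with hM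
    have hMle : M ≤ lcs G (k + 1 + 1) :=
      sup_le ((Subgroup.closure_le _).2 (iterComm_subset F (k + 1))) (lcs_antitone (by omega))
    -- `M` lies in `G_{k+2}`, which is central modulo `G_{k+3} ≤ M`.
    have hN : M.Normal := ⟨fun z hz g => by
      have h : ⁅g, z⁆ ∈ lcs G (k + 1 + 2) := by
        have := commutator_mem_lcs le_rfl (by omega) (show g ∈ lcs G 1 from Subgroup.mem_top g)
          (hMle hz)
        rwa [show 1 + (k + 1 + 1) = k + 1 + 2 by omega] at this
      have : g * z * g⁻¹ = ⁅g, z⁆ * z := by rw [commutatorElement_def]; group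
      rw [this]
      exact M.mul_mem ((le_sup_right : _ ≤ M) h) hz⟩
    have hcent : lcs G (k + 1) ≤ (Subgroup.center (G ⧸ M)).comap (QuotientGroup.mk' M) := by
      refine ih.trans (sup_le ((Subgroup.closure_le _).2 fun u hu => ?_) fun u hu => ?_)
      · have hle : Subgroup.closure F ≤
            (Subgroup.centralizer {QuotientGroup.mk' M u}).comap (QuotientGroup.mk' M) := by
          refine (Subgroup.closure_le _).2 fun s hs => ?_
          have : ⁅s, u⁆ ∈ M :=
            (le_sup_left : _ ≤ M) (Subgroup.subset_closure ⟨s, hs, u, hu, rfl⟩)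
          have h2 := (QuotientGroup.eq_one_iff _).2 this
          have h3 : Commute (QuotientGroup.mk' M s) (QuotientGroup.mk' M u) :=
            commutatorElement_eq_one_iff_commute.1 h2
          simp only [SetLike.mem_coe, Subgroup.mem_comap, Subgroup.mem_centralizer_singleton_iff]
          exact h3
        rw [hF] at hle
        simp only [SetLike.mem_coe, Subgroup.mem_comap, Subgroup.mem_center_iff]
        intro g
        obtain ⟨g, rfl⟩ := QuotientGroup.mk'_surjective M g
        have := hle (Subgroup.mem_top g)
        simp only [Subgroup.mem_comap, Subgroup.mem_centralizer_singleton_iff] at this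
        exact this
      · simp only [Subgroup.mem_comap, Subgroup.mem_center_iff]
        intro g
        obtain ⟨g, rfl⟩ := QuotientGroup.mk'_surjective M g
        have h : ⁅g, u⁆ ∈ lcs G (k + 1 + 2) := by
          have := commutator_mem_lcs le_rfl (by omega) (show g ∈ lcs G 1 from Subgroup.mem_top g)
            hu
          rwa [show 1 + (k + 2) = k + 1 + 2 by omega] at this
        have h2 := (QuotientGroup.eq_one_iff _).2 ((le_sup_right : _ ≤ M) h)
        exact (commutatorElement_eq_one_iff_commute.1 h2 :
          Commute (QuotientGroup.mk' M g) (QuotientGroup.mk' M u))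
    rw [lcs_succ G (k + 1) (by omega), Subgroup.commutator_le]
    intro g _ h hh
    have h1 := hcent hh
    simp only [Subgroup.mem_comap, Subgroup.mem_center_iff] at h1
    have h2 : Commute (QuotientGroup.mk' M g) (QuotientGroup.mk' M h) := h1 _
    rw [← commutatorElement_eq_one_iff_commute, ← map_commutatorElement] at h2
    exact (QuotientGroup.eq_one_iff _).1 h2

theorem lcs_le_closure_gens {F : Set G} (hF : Subgroup.closure F = ⊤) {j : ℕ} (hj : 1 ≤ j) :
    lcs G j ≤ Subgroup.closure (gens F j) ⊔ lcs G (j + 1) := by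
  obtain ⟨k, rfl⟩ := Nat.exists_eq_add_of_le' hj
  rw [gens, Subgroup.closure_sdiff_one]
  exact lcs_le_closure_iterComm hF k

/-- The weighted letters of weight at least `j`. -/
def letters (F : Set G) (j : ℕ) : Set (G × ℕ) := {p | j ≤ p.2 ∧ p.1 ∈ gens F p.2}

theorem letters_anti (F : Set G) {i j : ℕ} (h : i ≤ j) : letters F j ⊆ letters F i :=
  fun _ hp => ⟨h.trans hp.1, hp.2⟩

theorem letters_eq (F : Set G) (j : ℕ) :
    letters F j = (gens F j) ×ˢ {j} ∪ letters F (j + 1) := by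
  ext ⟨x, i⟩
  simp only [letters, Set.mem_ofPred_eq, Set.mem_union, Set.mem_prod, Set.mem_singleton_iff]
  constructor
  · rintro ⟨h, hx⟩
    rcases h.eq_or_lt with rfl | h
    · exact Or.inl ⟨hx, rfl⟩
    · exact Or.inr ⟨h, hx⟩
  · rintro (⟨hx, rfl⟩ | ⟨h, hx⟩)
    · exact ⟨le_rfl, hx⟩
    · exact ⟨by omega, hx⟩

theorem letters_subset_lcs (F : Set G) {j : ℕ} (hj : 1 ≤ j) {p : G × ℕ} (hp : p ∈ letters F j) :
    p.1 ∈ lcs G p.2 :=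
  gens_subset F (hj.trans hp.1) hp.2

theorem letters_finite [Group.IsNilpotent G] {F : Set G} (hF : F.Finite) {j : ℕ} (hj : 1 ≤ j) :
    (letters F j).Finite := by
  obtain ⟨d, hd⟩ := exists_lcs_add_eq_bot (G := G) 1
  refine ((Set.finite_Iio (1 + d)).biUnion
    fun i _ => ((iterComm_finite hF (i - 1)).prod (Set.finite_singleton i))).subset ?_
  rintro ⟨x, i⟩ hp
  have hi : i < 1 + d := by
    by_contra! h
    have := lcs_antitone h (letters_subset_lcs F hj hp)
    rw [hd] at this
    exact hp.2.2 this
  simp only [Set.mem_iUnion, Set.mem_prod, Set.mem_singleton_iff]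
  exact ⟨i, hi, hp.2.1, rfl⟩

theorem closure_letters [Group.IsNilpotent G] {F : Set G} (hF : Subgroup.closure F = ⊤) {j : ℕ}
    (hj : 1 ≤ j) : lcs G j ≤ Subgroup.closure (Prod.fst '' letters F j) := by
  obtain ⟨d, hd⟩ := exists_lcs_add_eq_bot (G := G) j
  induction d generalizing j with
  | zero => rw [add_zero] at hd; rw [hd]; exact bot_le
  | succ d ih =>
    refine (lcs_le_closure_gens hF hj).trans (sup_le (Subgroup.closure_mono fun x hx => ?_) ?_)
    · exact ⟨(x, j), ⟨le_rfl, hx⟩, rfl⟩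
    · refine (ih (by omega) (by rwa [show j + 1 + d = j + (d + 1) by omega])).trans
        (Subgroup.closure_mono (Set.image_mono (letters_anti F (by omega))))

end Generators

/-! ### Weighted words and the collection process. -/

section Rep

variable {G : Type*} [Group G]

/-- `Rep n S c g`: the element `g` is a word in letters `p.1 ^ ±1`, `p ∈ S`, of total cost at most
`c`, where the letter `p` costs `n ^ (-p.2)`. -/
inductive Rep (n : ℕ) (S : Set (G × ℕ)) : ℝ → G → Prop
  | one {c : ℝ} : 0 ≤ c → Rep n S c 1
  | cons {c d : ℝ} {g : G} {p : G × ℕ} : p ∈ S → Rep n S c g → c + ((n : ℝ) ^ p.2)⁻¹ ≤ d →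
      Rep n S d (p.1 * g)
  | cons_inv {c d : ℝ} {g : G} {p : G × ℕ} : p ∈ S → Rep n S c g → c + ((n : ℝ) ^ p.2)⁻¹ ≤ d →
      Rep n S d (p.1⁻¹ * g)

namespace Rep

variable {n : ℕ} {S T : Set (G × ℕ)} {c d : ℝ} {g h : G}

theorem mono (hg : Rep n S c g) (hcd : c ≤ d) : Rep n S d g := by
  cases hg with
  | one hc => exact one (hc.trans hcd)
  | cons hp hg h => exact cons hp hg (h.trans hcd)
  | cons_inv hp hg h => exact cons_inv hp hg (h.trans hcd)

theorem mono_set (hg : Rep n S c g) (hST : S ⊆ T) : Rep n T c g := by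
  induction hg with
  | one hc => exact one hc
  | cons hp _ h ih => exact cons (hST hp) ih h
  | cons_inv hp _ h ih => exact cons_inv (hST hp) ih h

theorem nonneg (hg : Rep n S c g) : 0 ≤ c := by
  induction hg with
  | one hc => exact hc
  | cons _ _ h ih => exact (add_nonneg ih (by positivity)).trans h
  | cons_inv _ _ h ih => exact (add_nonneg ih (by positivity)).trans h

theorem mul (hg : Rep n S c g) (hh : Rep n S d h) : Rep n S (c + d) (g * h) := by
  induction hg with
  | one hc => rw [one_mul]; exact hh.mono (by linarith)
  | cons hp _ h ih => rw [mul_assoc]; exact cons hp ih (by linarith)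
  | cons_inv hp _ h ih => rw [mul_assoc]; exact cons_inv hp ih (by linarith)

theorem of_mem {p : G × ℕ} (hp : p ∈ S) : Rep n S ((n : ℝ) ^ p.2)⁻¹ p.1 := by
  simpa using cons hp (one (n := n) (S := S) le_rfl) (d := ((n : ℝ) ^ p.2)⁻¹) (by simp)

theorem of_mem_inv {p : G × ℕ} (hp : p ∈ S) : Rep n S ((n : ℝ) ^ p.2)⁻¹ p.1⁻¹ := by
  simpa using cons_inv hp (one (n := n) (S := S) le_rfl) (d := ((n : ℝ) ^ p.2)⁻¹) (by simp)

theorem inv (hg : Rep n S c g) : Rep n S c g⁻¹ := by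
  induction hg with
  | one hc => rw [inv_one]; exact one hc
  | cons hp _ h ih => rw [mul_inv_rev]; exact (ih.mul (of_mem_inv hp)).mono h
  | cons_inv hp _ h ih =>
    rw [mul_inv_rev, inv_inv]; exact (ih.mul (of_mem hp)).mono h

theorem pow (hg : Rep n S c g) (k : ℕ) : Rep n S (k * c) (g ^ k) := by
  induction k with
  | zero => rw [pow_zero]; exact one (by simp)
  | succ k ih => rw [pow_succ]; exact (ih.mul hg).mono (by push_cast; linarith)

theorem zpow (hg : Rep n S c g) (k : ℤ) : Rep n S (|(k : ℝ)| * c) (g ^ k) := by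
  obtain ⟨m, rfl | rfl⟩ := k.eq_nat_or_neg
  · rw [zpow_natCast]; simpa using hg.pow m
  · rw [zpow_neg, zpow_natCast]; simpa using (hg.pow m).inv

theorem mem_closure (hg : Rep n S c g) : g ∈ Subgroup.closure (Prod.fst '' S) := by
  induction hg with
  | one => exact Subgroup.one_mem _
  | cons hp _ _ ih => exact Subgroup.mul_mem _ (Subgroup.subset_closure ⟨_, hp, rfl⟩) ih
  | cons_inv hp _ _ ih =>
    exact Subgroup.mul_mem _ (Subgroup.inv_mem _ (Subgroup.subset_closure ⟨_, hp, rfl⟩)) ih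

end Rep

/-- A fixed product of letters of weight at least `i` has cost `O(n ^ (-i))`. -/
theorem exists_rep_of_mem_closure {S : Set (G × ℕ)} {i : ℕ} (hS : ∀ p ∈ S, i ≤ p.2) {g : G}
    (hg : g ∈ Subgroup.closure (Prod.fst '' S)) :
    ∃ K : ℝ, 0 ≤ K ∧ ∀ n : ℕ, 1 ≤ n → Rep n S (K * ((n : ℝ) ^ i)⁻¹) g := by
  induction hg using Subgroup.closure_induction with
  | mem x hx =>
    obtain ⟨p, hp, rfl⟩ := hx
    refine ⟨1, zero_le_one, fun n hn => (Rep.of_mem hp).mono ?_⟩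
    rw [one_mul]
    have : (1 : ℝ) ≤ n := by exact_mod_cast hn
    exact inv_anti₀ (by positivity) (pow_le_pow_right₀ this (hS p hp))
  | one => exact ⟨0, le_rfl, fun n _ => Rep.one (by simp)⟩
  | mul x y _ _ hx hy =>
    obtain ⟨K, hK, h⟩ := hx
    obtain ⟨K', hK', h'⟩ := hy
    exact ⟨K + K', by positivity, fun n hn => by rw [add_mul]; exact (h n hn).mul (h' n hn)⟩
  | inv x _ hx =>
    obtain ⟨K, hK, h⟩ := hx
    exact ⟨K, hK, fun n hn => (h n hn).inv⟩

theorem rep_letters_mem_lcs {F : Set G} {n j : ℕ} (hj : 1 ≤ j) {c : ℝ} {g : G}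
    (hg : Rep n (letters F j) c g) : g ∈ lcs G j := by
  refine (Subgroup.closure_le _).2 ?_ hg.mem_closure
  rintro _ ⟨p, hp, rfl⟩
  exact lcs_antitone hp.1 (letters_subset_lcs F hj hp)

variable {F : Set G}

/-- Pulling a letter `t` of weight `j` to the left of a word in `t` and letters from `S`. -/
theorem Rep.exists_eq_zpow_mul {S : Set (G × ℕ)} {t : G} {j n : ℕ} {C K c : ℝ} {g : G}
    (hn : 1 ≤ n) (hK : 0 ≤ K)
    (hconj : ∀ p ∈ S, ∀ k : ℤ, |(k : ℝ)| ≤ C * (n : ℝ) ^ j →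
      Rep n S (K * ((n : ℝ) ^ p.2)⁻¹) ((t ^ k)⁻¹ * p.1 * t ^ k))
    (hg : Rep n (insert (t, j) S) c g) (hc : c ≤ C) :
    ∃ (k : ℤ) (g' : G), g = t ^ k * g' ∧ |(k : ℝ)| ≤ c * (n : ℝ) ^ j ∧ Rep n S (K * c) g' := by
  have hn' : (0 : ℝ) < n := by exact_mod_cast hn
  induction hg with
  | one h => exact ⟨0, 1, by simp, by simp; positivity, Rep.one (by positivity)⟩
  | @cons c d g p hp hg h ih =>
    have hpos : 0 < ((n : ℝ) ^ p.2)⁻¹ := by positivity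
    -- A letter `t` changes the exponent by one and pays `n ^ (-j)` for it; any other letter passes
    -- `t ^ k` by conjugation. The exponent never exceeds the cost so far times `n ^ j`, so `hconj`
    -- always applies.
    obtain ⟨k, g', rfl, hk, hg'⟩ := ih (by linarith)
    rcases hp with rfl | hp
    · refine ⟨k + 1, g', by rw [← mul_assoc, zpow_add_one, mul_self_zpow, zpow_add_one], ?_,
        hg'.mono (by gcongr; linarith)⟩
      push_cast
      calc |(k : ℝ) + 1| ≤ |(k : ℝ)| + 1 := by simpa using abs_add_le (k : ℝ) 1
        _ ≤ (c + ((n : ℝ) ^ j)⁻¹) * (n : ℝ) ^ j := by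
          rw [add_mul, inv_mul_cancel₀ (by positivity)]; linarith
        _ ≤ _ := by gcongr
    · refine ⟨k, ((t ^ k)⁻¹ * p.1 * t ^ k) * g', by group, hk.trans (by gcongr; linarith), ?_⟩
      refine ((hconj p hp k (hk.trans (by gcongr; linarith))).mul hg').mono ?_
      rw [← mul_add]
      gcongr
      linarith
  | @cons_inv c d g p hp hg h ih =>
    have hpos : 0 < ((n : ℝ) ^ p.2)⁻¹ := by positivity
    obtain ⟨k, g', rfl, hk, hg'⟩ := ih (by linarith)
    rcases hp with rfl | hp
    · refine ⟨k - 1, g', by group, ?_, hg'.mono (by gcongr; linarith)⟩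
      push_cast
      calc |(k : ℝ) - 1| ≤ |(k : ℝ)| + 1 := by simpa using abs_sub (k : ℝ) 1
        _ ≤ (c + ((n : ℝ) ^ j)⁻¹) * (n : ℝ) ^ j := by
          rw [add_mul, inv_mul_cancel₀ (by positivity)]; linarith
        _ ≤ _ := by gcongr
    · refine ⟨k, ((t ^ k)⁻¹ * p.1 * t ^ k)⁻¹ * g', by group, hk.trans (by gcongr; linarith), ?_⟩
      refine ((hconj p hp k (hk.trans (by gcongr; linarith))).inv.mul hg').mono ?_
      rw [← mul_add]
      gcongr
      linarith

/-- The letters `x ∈ l`, with weight `j`, and all letters of weight greater than `j`. -/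
def lettersWith (F : Set G) (j : ℕ) (l : Set G) : Set (G × ℕ) := l ×ˢ {j} ∪ letters F (j + 1)

theorem lettersWith_insert (j : ℕ) (t : G) (l : Set G) :
    lettersWith F j (insert t l) = insert (t, j) (lettersWith F j l) := by
  ext ⟨x, i⟩
  simp only [lettersWith, Set.mem_union, Set.mem_prod, Set.mem_insert_iff, Set.mem_singleton_iff,
    Prod.mk.injEq]
  tauto

theorem lettersWith_empty (j : ℕ) : lettersWith F j ∅ = letters F (j + 1) := by
  simp [lettersWith]

/-- The exponents form a subgroup of `ℤ`; `q = 0` occurs when no nontrivial exponent works. -/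
theorem exists_zpow_mem_iff_dvd (t : G) (M : Subgroup G) :
    ∃ q : ℤ, t ^ q ∈ M ∧ ∀ k : ℤ, t ^ k ∈ M ↔ q ∣ k := by
  let A : AddSubgroup ℤ :=
    { carrier := {k | t ^ k ∈ M}
      zero_mem' := by simp
      add_mem' := fun {a b} ha hb => by
        simp only [Set.mem_ofPred_eq, zpow_add] at *
        exact M.mul_mem ha hb
      neg_mem' := fun {a} ha => by
        simp only [Set.mem_ofPred_eq, zpow_neg] at *
        exact M.inv_mem ha }
  obtain ⟨q, hq⟩ := Int.subgroup_cyclic A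
  have h : ∀ k : ℤ, t ^ k ∈ M ↔ q ∣ k := fun k => by
    change k ∈ A ↔ _
    rw [hq, ← AddSubgroup.zmultiples_eq_closure, Int.mem_zmultiples_iff]
  exact ⟨q, (h q).2 dvd_rfl, h⟩

theorem gens_finite (hfin : F.Finite) (j : ℕ) : (gens F j).Finite :=
  (iterComm_finite hfin _).sdiff

variable [Group.IsNilpotent G]

theorem exists_rep_of_mem_lcs (hF : Subgroup.closure F = ⊤) {i : ℕ} (hi : 1 ≤ i) {g : G}
    (hg : g ∈ lcs G i) :
    ∃ K : ℝ, 0 ≤ K ∧ ∀ n : ℕ, 1 ≤ n → Rep n (letters F i) (K * ((n : ℝ) ^ i)⁻¹) g :=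
  exists_rep_of_mem_closure (fun _ hp => hp.1) (closure_letters hF hi hg)

/-- The exchange rate of weights: taking `O(n ^ j)` copies of something of weight `i + j` costs as
much as weight `i`. -/
theorem cost_le {n i j : ℕ} (hn : 1 ≤ n) {k C K : ℝ} (hK : 0 ≤ K) (hk : k ≤ C * (n : ℝ) ^ j) :
    k * (K * ((n : ℝ) ^ (i + j))⁻¹) ≤ C * K * ((n : ℝ) ^ i)⁻¹ := by
  have hn' : (0 : ℝ) < n := by exact_mod_cast hn
  calc k * (K * ((n : ℝ) ^ (i + j))⁻¹) ≤ (C * (n : ℝ) ^ j) * (K * ((n : ℝ) ^ (i + j))⁻¹) := by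
        gcongr
    _ = _ := by rw [pow_add]; field_simp

/-- Conjugating a fixed element of `G_i` by the `k`-th power of a fixed element of `G_j`, where
`k = O(n ^ j)`, changes it by an element of cost `O(n ^ (-i))`. -/
theorem exists_rep_conj_pow (hF : Subgroup.closure F = ⊤) {i j : ℕ} (hi : 1 ≤ i) (hj : 1 ≤ j)
    {g t : G} (hg : g ∈ lcs G i) (ht : t ∈ lcs G j) {C : ℝ} (hC : 0 ≤ C) :
    ∃ K : ℝ, 0 ≤ K ∧ ∀ n : ℕ, 1 ≤ n → ∀ k : ℕ, (k : ℝ) ≤ C * (n : ℝ) ^ j →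
      Rep n (letters F (i + j)) (K * ((n : ℝ) ^ i)⁻¹) (g⁻¹ * (t ^ k)⁻¹ * g * t ^ k) := by
  obtain ⟨d, hd⟩ := exists_lcs_add_eq_bot (G := G) i
  induction d generalizing i g with
  | zero =>
    rw [add_zero] at hd
    rw [hd, Subgroup.mem_bot] at hg
    subst hg
    exact ⟨0, le_rfl, fun n _ k _ => by simpa using Rep.one le_rfl⟩
  | succ d ih =>
    -- This commutator `D` lies deeper than `g`, so the induction hypothesis controls its own
    -- conjugates by `t ^ k`.
    have hD : g⁻¹ * t⁻¹ * g * t ∈ lcs G (i + j) := by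
      simpa [commutatorElement_def] using
        commutator_mem_lcs hi hj (inv_mem hg) (inv_mem ht)
    obtain ⟨K₀, hK₀, h₀⟩ := exists_rep_of_mem_lcs hF (by omega) hD
    obtain ⟨K₁, hK₁, h₁⟩ := ih (by omega) hD
      (le_bot_iff.1 (hd ▸ lcs_antitone (by omega)))
    refine ⟨C * (K₀ + K₁), by positivity, fun n hn k hk => ?_⟩
    refine Rep.mono ?_ (cost_le hn (by positivity) hk)
    induction k with
    | zero => simpa using Rep.one le_rfl
    | succ k ihk =>
      have hk' : (k : ℝ) ≤ C * (n : ℝ) ^ j := le_trans (by push_cast; linarith) hk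
      -- Raising `k` by one multiplies by the conjugate of `D` by `t ^ k`, of cost at most `(K₀ +
      -- K₁) * n ^ (-(i + j))`; at most `C * n ^ j` such steps occur.
      have e : g⁻¹ * (t ^ (k + 1))⁻¹ * g * t ^ (k + 1) =
          (g⁻¹ * (t ^ k)⁻¹ * g * t ^ k) * ((g⁻¹ * t⁻¹ * g * t) *
            ((g⁻¹ * t⁻¹ * g * t)⁻¹ * (t ^ k)⁻¹ * (g⁻¹ * t⁻¹ * g * t) * t ^ k)) := by
        rw [pow_succ']
        group
      rw [e]
      refine ((ihk hk').mul ((h₀ n hn).mul ((h₁ n hn k hk').mono_set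
        (letters_anti F (by omega))))).mono (le_of_eq ?_)
      push_cast
      ring

theorem exists_rep_conj_zpow (hF : Subgroup.closure F = ⊤) {i j : ℕ} (hi : 1 ≤ i) (hj : 1 ≤ j)
    {g t : G} (hg : g ∈ lcs G i) (ht : t ∈ lcs G j) {C : ℝ} (hC : 0 ≤ C) :
    ∃ K : ℝ, 0 ≤ K ∧ ∀ n : ℕ, 1 ≤ n → ∀ k : ℤ, |(k : ℝ)| ≤ C * (n : ℝ) ^ j →
      Rep n (letters F (i + j)) (K * ((n : ℝ) ^ i)⁻¹) (g⁻¹ * (t ^ k)⁻¹ * g * t ^ k) := by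
  obtain ⟨K₀, hK₀, h₀⟩ := exists_rep_conj_pow hF hi hj hg ht hC
  obtain ⟨K₁, hK₁, h₁⟩ := exists_rep_conj_pow hF hi hj hg (inv_mem ht) hC
  refine ⟨max K₀ K₁, le_max_of_le_left hK₀, fun n hn k hk => ?_⟩
  obtain ⟨m, rfl | rfl⟩ := k.eq_nat_or_neg
  · rw [zpow_natCast]
    refine (h₀ n hn m (by simpa using hk)).mono ?_
    gcongr
    exact le_max_left _ _
  · rw [zpow_neg, zpow_natCast, ← inv_pow t m]
    refine (h₁ n hn m (by simpa using hk)).mono ?_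
    gcongr
    exact le_max_right _ _

/-- One collection step with uniform constants, available because there are finitely many letters.
Conjugating `p.1` by `t ^ k` gives `p.1` times letters of weight at least `p.2 + j > j`, so `t` is
not reintroduced. -/
theorem exists_zpow_mul_of_rep_insert (hF : Subgroup.closure F = ⊤) (hfin : F.Finite) {j : ℕ}
    (hj : 1 ≤ j) {t : G} (ht : t ∈ lcs G j) {l : Set G} (hl : l.Finite) (hlj : l ⊆ lcs G j)
    {C : ℝ} (hC : 0 ≤ C) :
    ∃ K : ℝ, 0 ≤ K ∧ ∀ n : ℕ, 1 ≤ n → ∀ g, Rep n (lettersWith F j (insert t l)) C g →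
      ∃ (k : ℤ) (g' : G), g = t ^ k * g' ∧ |(k : ℝ)| ≤ C * (n : ℝ) ^ j ∧
        Rep n (lettersWith F j l) K g' := by
  have hS : (lettersWith F j l).Finite :=
    (hl.prod (Set.finite_singleton j)).union (letters_finite hfin (by omega))
  have hp : ∀ p ∈ lettersWith F j l, j ≤ p.2 ∧ p.1 ∈ lcs G p.2 := by
    rintro ⟨x, i⟩ (⟨hx, hi⟩ | hp)
    · obtain rfl : i = j := hi
      exact ⟨le_rfl, hlj hx⟩
    · exact ⟨(Nat.le_succ j).trans hp.1, letters_subset_lcs F (by omega) hp⟩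
  have hconj : ∀ p ∈ lettersWith F j l, ∃ K : ℝ, 0 ≤ K ∧ ∀ n : ℕ, 1 ≤ n → ∀ k : ℤ,
      |(k : ℝ)| ≤ C * (n : ℝ) ^ j → Rep n (lettersWith F j l) (K * ((n : ℝ) ^ p.2)⁻¹)
        ((t ^ k)⁻¹ * p.1 * t ^ k) := by
    intro p hpS
    obtain ⟨K, hK, h⟩ := exists_rep_conj_zpow hF (hj.trans (hp p hpS).1) hj (hp p hpS).2 ht hC
    refine ⟨1 + K, by positivity, fun n hn k hk => ?_⟩
    have e : (t ^ k)⁻¹ * p.1 * t ^ k = p.1 * (p.1⁻¹ * (t ^ k)⁻¹ * p.1 * t ^ k) := by group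
    rw [e, add_mul, one_mul]
    refine (Rep.of_mem hpS).mul ((h n hn k hk).mono_set ?_)
    exact (letters_anti F (by have := (hp p hpS).1; omega)).trans Set.subset_union_right
  choose! K hK h using hconj
  obtain ⟨M, hM⟩ := (hS.image K).bddAbove
  refine ⟨max M 0 * C, by positivity, fun n hn g hg => ?_⟩
  rw [lettersWith_insert] at hg
  refine hg.exists_eq_zpow_mul hn (le_max_right M 0) (fun p hpS k hk => ?_) le_rfl
  refine (h p hpS n hn k hk).mono ?_
  gcongr
  exact le_max_of_le_left (hM ⟨p, hpS, rfl⟩)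

/-- A word of bounded cost with value in `G_{j+1}` can be rewritten without letters of weight
`j`. -/
theorem exists_rep_letters_succ_of_lettersWith (hF : Subgroup.closure F = ⊤) (hfin : F.Finite)
    {j : ℕ} (hj : 1 ≤ j) {l : Set G} (hl : l.Finite) (hlj : l ⊆ lcs G j) {C : ℝ} (hC : 0 ≤ C) :
    ∃ K : ℝ, 0 ≤ K ∧ ∀ n : ℕ, 1 ≤ n → ∀ g ∈ lcs G (j + 1), Rep n (lettersWith F j l) C g →
      Rep n (letters F (j + 1)) K g := by
  induction l, hl using Set.Finite.induction_on generalizing C with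
  | empty => exact ⟨C, hC, fun n _ g _ h => by rwa [lettersWith_empty] at h⟩
  | @insert t l _ hl ih =>
    have ht : t ∈ lcs G j := hlj (Set.mem_insert _ _)
    have hl' : l ⊆ lcs G j := (Set.subset_insert _ _).trans hlj
    obtain ⟨K₁, hK₁, h₁⟩ := exists_zpow_mul_of_rep_insert hF hfin hj ht hl hl' hC
    -- The exponents putting a power of `t` into `M` are the multiples of one `q`, and `t ^ q` is a
    -- fixed word in the remaining letters. The collected power is a power of `t ^ q`, so it can be
    -- rewritten at bounded cost.
    set M := Subgroup.closure (Prod.fst '' lettersWith F j l)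
    have hjM : lcs G (j + 1) ≤ M := (closure_letters hF (by omega)).trans
      (Subgroup.closure_mono (Set.image_mono Set.subset_union_right))
    obtain ⟨q, hqM, hq⟩ := exists_zpow_mem_iff_dvd t M
    obtain ⟨K₂, hK₂, h₂⟩ := exists_rep_of_mem_closure (S := lettersWith F j l) (i := j)
      (by
        rintro ⟨x, i⟩ (⟨-, hi⟩ | hp)
        · exact (show i = j from hi).ge
        · exact (Nat.le_succ j).trans hp.1) hqM
    obtain ⟨K₃, hK₃, h₃⟩ := ih hl' (C := C * K₂ + K₁) (by positivity)
    refine ⟨K₃, hK₃, fun n hn g hg hrep => h₃ n hn g hg ?_⟩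
    obtain ⟨k, g', rfl, hk, hg'⟩ := h₁ n hn g hrep
    refine Rep.mul ?_ hg'
    have hkM : t ^ k ∈ M := by
      have := M.mul_mem (hjM hg) (M.inv_mem hg'.mem_closure)
      rwa [mul_inv_cancel_right] at this
    obtain ⟨b, rfl⟩ := (hq k).1 hkM
    rcases eq_or_ne q 0 with rfl | hq0
    · rw [zero_mul, zpow_zero]
      exact Rep.one (by positivity)
    rw [zpow_mul]
    have hb : |(b : ℝ)| ≤ C * (n : ℝ) ^ j := by
      refine le_trans ?_ hk
      rw [Int.cast_mul, abs_mul]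
      refine le_mul_of_one_le_left (abs_nonneg _) ?_
      exact_mod_cast Int.one_le_abs hq0
    refine ((h₂ n hn).zpow b).mono ?_
    simpa using cost_le (i := 0) hn hK₂ hb

theorem exists_rep_letters_succ (hF : Subgroup.closure F = ⊤) (hfin : F.Finite)
    {j : ℕ} (hj : 1 ≤ j) {C : ℝ} (hC : 0 ≤ C) :
    ∃ K : ℝ, 0 ≤ K ∧ ∀ n : ℕ, 1 ≤ n → ∀ g ∈ lcs G (j + 1), Rep n (letters F j) C g →
      Rep n (letters F (j + 1)) K g := by
  rw [letters_eq]
  exact exists_rep_letters_succ_of_lettersWith hF hfin hj (gens_finite hfin j)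
    (gens_subset F hj) hC

/-- An element of `G_j` of bounded cost has bounded cost in letters of weight at least `j`. -/
theorem exists_rep_letters_of_mem_lcs (hF : Subgroup.closure F = ⊤) (hfin : F.Finite)
    {j : ℕ} (hj : 1 ≤ j) {C : ℝ} (hC : 0 ≤ C) :
    ∃ K : ℝ, 0 ≤ K ∧ ∀ n : ℕ, 1 ≤ n → ∀ g ∈ lcs G j, Rep n (letters F 1) C g →
      Rep n (letters F j) K g := by
  induction j, hj using Nat.le_induction with
  | base => exact ⟨C, hC, fun n _ g _ h => h⟩
  | succ j hj ih =>
    obtain ⟨K₁, hK₁, h₁⟩ := ih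
    obtain ⟨K₂, hK₂, h₂⟩ := exists_rep_letters_succ hF hfin hj hK₁
    exact ⟨K₂, hK₂, fun n hn g hg h =>
      h₂ n hn g hg (h₁ n hn g (lcs_antitone (Nat.le_succ j) hg) h)⟩

end Rep

/-! ### Bounded cost implies linear word length. -/

section WordBall

variable {G : Type*} [Group G] {F : Set G}

/-- The products of at most `n` elements of `F ∪ F⁻¹`. -/
def wordBall (F : Set G) (n : ℕ) : Set G := (F ∪ F⁻¹ ∪ {1}) ^ n

theorem wordBall_finite (hF : F.Finite) (n : ℕ) : (wordBall F n).Finite := by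
  induction n with
  | zero => rw [wordBall, pow_zero]; exact Set.finite_one
  | succ n ih =>
    rw [wordBall, pow_succ]
    exact ih.mul ((hF.union hF.inv).union (Set.finite_singleton 1))

theorem wordBall_mono {m n : ℕ} (h : m ≤ n) : wordBall F m ⊆ wordBall F n :=
  Set.pow_subset_pow_right (Or.inr rfl) h

theorem one_mem_wordBall (n : ℕ) : (1 : G) ∈ wordBall F n :=
  Set.one_mem_pow (Or.inr rfl)

theorem mul_mem_wordBall {m n : ℕ} {x y : G} (hx : x ∈ wordBall F m) (hy : y ∈ wordBall F n) :
    x * y ∈ wordBall F (m + n) := by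
  rw [wordBall, pow_add]
  exact Set.mul_mem_mul hx hy

theorem inv_mem_wordBall {n : ℕ} {x : G} (hx : x ∈ wordBall F n) : x⁻¹ ∈ wordBall F n := by
  have h : (F ∪ F⁻¹ ∪ {1})⁻¹ = F ∪ F⁻¹ ∪ {1} := by
    rw [Set.union_inv, Set.union_inv, inv_inv, Set.inv_singleton, inv_one, Set.union_comm F⁻¹]
  rw [wordBall, ← h, inv_pow]
  exact Set.inv_mem_inv.2 hx

theorem pow_mem_wordBall {n : ℕ} {x : G} (hx : x ∈ wordBall F n) (k : ℕ) :
    x ^ k ∈ wordBall F (n * k) := by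
  rw [wordBall, pow_mul]
  exact Set.pow_mem_pow hx

theorem exists_mem_wordBall (hF : Subgroup.closure F = ⊤) (g : G) : ∃ n, g ∈ wordBall F n := by
  have hg : g ∈ Subgroup.closure F := hF ▸ Subgroup.mem_top g
  induction hg using Subgroup.closure_induction with
  | mem x hx => exact ⟨1, by rw [wordBall, pow_one]; exact Or.inl (Or.inl hx)⟩
  | one => exact ⟨0, one_mem_wordBall 0⟩
  | mul x y _ _ hx hy =>
    obtain ⟨m, hm⟩ := hx
    obtain ⟨n, hn⟩ := hy
    exact ⟨m + n, mul_mem_wordBall hm hn⟩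
  | inv x _ hx =>
    obtain ⟨n, hn⟩ := hx
    exact ⟨n, inv_mem_wordBall hn⟩

theorem rep_of_mem_wordBall {m : ℕ} {x : G} (hx : x ∈ wordBall F m) (n : ℕ) :
    Rep n (letters F 1) (m * (n : ℝ)⁻¹) x := by
  induction m generalizing x with
  | zero =>
    obtain rfl : x = 1 := by simpa [wordBall] using hx
    exact Rep.one (by simp)
  | succ m ih =>
    rw [wordBall, pow_succ] at hx
    obtain ⟨y, hy, z, hz, rfl⟩ := hx
    have hz' : Rep n (letters F 1) (n : ℝ)⁻¹ z := by
      -- `gens` omits the identity, so a trivial factor is not a letter and is given the empty word.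
      by_cases h1 : z = 1
      · rw [h1]
        exact Rep.one (by positivity)
      have hF : ∀ x ∈ F, x ≠ 1 → (x, 1) ∈ letters F 1 := fun x hx h => ⟨le_rfl, hx, h⟩
      rcases hz with (hz | hz) | hz
      · simpa using Rep.of_mem (n := n) (hF z hz h1)
      · simpa using Rep.of_mem_inv (n := n) (hF z⁻¹ hz (inv_ne_one.2 h1))
      · exact absurd hz h1
    refine ((ih hy).mul hz').mono (le_of_eq ?_)
    push_cast
    ring

/-- Bilinearity of the commutator when it is central, via two conjugations: `u` by `s`, then `s` by
`u ^ b`. -/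
theorem commutatorElement_pow_pow {s u : G} (hs : Commute ⁅s, u⁆ s) (hu : Commute ⁅s, u⁆ u)
    (a b : ℕ) : ⁅s ^ a, u ^ b⁆ = ⁅s, u⁆ ^ (a * b) := by
  have h1 : ⁅s, u ^ b⁆ = ⁅s, u⁆ ^ b := by
    have : s * u * s⁻¹ = ⁅s, u⁆ * u := by rw [commutatorElement_def]; group
    rw [commutatorElement_def, ← conj_pow, this, hu.mul_pow, mul_inv_cancel_right]
  have hw : Commute ⁅s, u ^ b⁆⁻¹ s := by rw [h1]; exact (hs.pow_left b).inv_left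
  have h2 : u ^ b * s * (u ^ b)⁻¹ = ⁅s, u ^ b⁆⁻¹ * s := by rw [commutatorElement_def]; group
  have h3 : ⁅s ^ a, u ^ b⁆ = s ^ a * (u ^ b * s ^ a * (u ^ b)⁻¹)⁻¹ := by
    rw [commutatorElement_def]; group
  rw [h3, ← conj_pow, h2, hw.mul_pow, mul_inv_rev, mul_inv_cancel_left, inv_pow, inv_inv, h1,
    ← pow_mul, mul_comm]

/-- An error in `G_i` in the second entry is central modulo `G_{i+1}`, hence cancels from the
commutator. -/
theorem mk_commutatorElement_congr {i : ℕ} (hi : 1 ≤ i) {s b v : G}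
    (h : (b : G ⧸ lcs G i) = v) :
    ((⁅s, b⁆ : G) : G ⧸ lcs G (i + 1)) = (⁅s, v⁆ : G) := by
  have hc : v⁻¹ * b ∈ lcs G i := QuotientGroup.eq.1 h.symm
  obtain ⟨c, rfl⟩ : ∃ c, b = v * c := ⟨v⁻¹ * b, by group⟩
  rw [inv_mul_cancel_left] at hc
  have hcs := commute_mk_of_mem_lcs hi hc s
  simp only [commutatorElement_def, QuotientGroup.mk_mul, QuotientGroup.mk_inv, mul_inv_rev]
  have := hcs.inv_right.eq
  generalize (s : G ⧸ lcs G (i + 1)) = s, (v : G ⧸ lcs G (i + 1)) = v,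
    (c : G ⧸ lcs G (i + 1)) = c at *
  calc s * (v * c) * s⁻¹ * (c⁻¹ * v⁻¹) = s * v * (c * s⁻¹) * c⁻¹ * v⁻¹ := by group
    _ = _ := by rw [this]; group

/-- Modulo `G_{i+1}`, the `k`-th power of an element of `G_i` with `k ≤ n ^ i` has length
`O(n)`. -/
theorem exists_wordBall_eq_pow (hF : Subgroup.closure F = ⊤) {i : ℕ} (hi : 1 ≤ i) {u : G}
    (hu : u ∈ lcs G i) :
    ∃ K : ℕ, ∀ n : ℕ, 1 ≤ n → ∀ k ≤ n ^ i, ∃ b ∈ wordBall F (K * n),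
      (b : G ⧸ lcs G (i + 1)) = (u : G ⧸ lcs G (i + 1)) ^ k := by
  induction i, hi using Nat.le_induction generalizing u with
  | base =>
    obtain ⟨K, hK⟩ := exists_mem_wordBall hF u
    refine ⟨K, fun n _ k hk => ⟨u ^ k, ?_, rfl⟩⟩
    exact wordBall_mono (Nat.mul_le_mul_left K (by simpa using hk)) (pow_mem_wordBall hK k)
  | succ i hi ih =>
    have hu' := hu
    rw [lcs_succ G i hi, Subgroup.commutator_def] at hu
    induction hu using Subgroup.closure_induction with
    | mem z hz =>
      obtain ⟨s, -, u, hu, rfl⟩ := hz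
      obtain ⟨Ks, hs⟩ := exists_mem_wordBall hF s
      obtain ⟨K, hK⟩ := ih hu
      refine ⟨4 * (Ks + K), fun n hn k hk => ?_⟩
      -- Divide: `k = a * n ^ i + r` with `a ≤ n` and `r < n ^ i`. Then `⁅s, u⁆ ^ k` is `⁅s ^ a, u ^
      -- (n ^ i)⁆ * ⁅s, u ^ r⁆` modulo `G_{i+2}`, and induction shortens the two powers of `u`.
      have hni : 0 < n ^ i := by positivity
      obtain ⟨b₁, hb₁, e₁⟩ := hK n hn (n ^ i) le_rfl
      obtain ⟨b₂, hb₂, e₂⟩ := hK n hn (k % n ^ i) (Nat.mod_lt _ hni).le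
      have ha : k / n ^ i ≤ n := by
        rw [pow_succ'] at hk
        exact Nat.div_le_of_le_mul (by rwa [mul_comm])
      refine ⟨⁅s ^ (k / n ^ i), b₁⁆ * ⁅s, b₂⁆, ?_, ?_⟩
      · have hsa := pow_mem_wordBall hs (k / n ^ i)
        refine wordBall_mono ?_ (mul_mem_wordBall
          (mul_mem_wordBall (mul_mem_wordBall (mul_mem_wordBall hsa hb₁) (inv_mem_wordBall hsa))
            (inv_mem_wordBall hb₁))
          (mul_mem_wordBall (mul_mem_wordBall (mul_mem_wordBall hs hb₂) (inv_mem_wordBall hs))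
            (inv_mem_wordBall hb₂)))
        have h1 : Ks * (k / n ^ i) ≤ Ks * n := Nat.mul_le_mul_left _ ha
        have h2 : Ks ≤ Ks * n := Nat.le_mul_of_pos_right _ hn
        calc _ ≤ Ks * n + K * n + Ks * n + K * n + (Ks * n + K * n + Ks * n + K * n) := by gcongr
          _ = _ := by ring
      · have hz1 := commute_mk_of_mem_lcs (show 1 ≤ i + 1 by omega) hu' s
        have hz2 := commute_mk_of_mem_lcs (show 1 ≤ i + 1 by omega) hu' u
        have key : ∀ a b : ℕ, ((⁅s ^ a, u ^ b⁆ : G) : G ⧸ lcs G (i + 1 + 1)) =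
            ((⁅s, u⁆ : G) : G ⧸ lcs G (i + 1 + 1)) ^ (a * b) :=
          fun a b => commutatorElement_pow_pow (s := (s : G ⧸ lcs G (i + 1 + 1)))
            (u := (u : G ⧸ lcs G (i + 1 + 1))) hz1 hz2 a b
        rw [QuotientGroup.mk_mul, mk_commutatorElement_congr (by omega) e₁,
          mk_commutatorElement_congr (v := u ^ (k % n ^ i)) (by omega) e₂, key]
        have := key 1 (k % n ^ i)
        rw [pow_one] at this
        rw [this, ← pow_add, one_mul, Nat.div_add_mod']
    | one => exact ⟨0, fun n _ k _ => ⟨1, one_mem_wordBall _, by simp⟩⟩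
    | mul x y hx hy ihx ihy =>
      rw [← Subgroup.commutator_def, ← lcs_succ G i hi] at hx hy
      obtain ⟨K₁, h₁⟩ := ihx hx
      obtain ⟨K₂, h₂⟩ := ihy hy
      refine ⟨K₁ + K₂, fun n hn k hk => ?_⟩
      obtain ⟨b₁, hb₁, e₁⟩ := h₁ n hn k hk
      obtain ⟨b₂, hb₂, e₂⟩ := h₂ n hn k hk
      refine ⟨b₁ * b₂, by rw [add_mul]; exact mul_mem_wordBall hb₁ hb₂, ?_⟩
      rw [QuotientGroup.mk_mul, QuotientGroup.mk_mul, e₁, e₂,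
        (commute_mk_of_mem_lcs (by omega) hx y).mul_pow]
    | inv x hx ihx =>
      rw [← Subgroup.commutator_def, ← lcs_succ G i hi] at hx
      obtain ⟨K₁, h₁⟩ := ihx hx
      refine ⟨K₁, fun n hn k hk => ?_⟩
      obtain ⟨b₁, hb₁, e₁⟩ := h₁ n hn k hk
      exact ⟨b₁⁻¹, inv_mem_wordBall hb₁, by
        rw [QuotientGroup.mk_inv, QuotientGroup.mk_inv, e₁, inv_pow]⟩

/-- The constant `C` is absorbed by passing to scale `N * n`: since `i ≥ 1`, `C ≤ N ≤ N ^ i`. -/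
theorem exists_wordBall_eq_zpow (hF : Subgroup.closure F = ⊤) {i : ℕ} (hi : 1 ≤ i) {u : G}
    (hu : u ∈ lcs G i) (C : ℝ) :
    ∃ K : ℕ, ∀ n : ℕ, 1 ≤ n → ∀ k : ℤ, |(k : ℝ)| ≤ C * (n : ℝ) ^ i → ∃ b ∈ wordBall F (K * n),
      (b : G ⧸ lcs G (i + 1)) = (u : G ⧸ lcs G (i + 1)) ^ k := by
  obtain ⟨K, hK⟩ := exists_wordBall_eq_pow hF hi hu
  set N := ⌈C⌉₊ + 1 with hN
  refine ⟨K * N, fun n hn k hk => ?_⟩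
  have hC : C ≤ (N : ℝ) ^ i := by
    have h1 : C ≤ N := (Nat.le_ceil C).trans (by rw [hN]; push_cast; linarith)
    have h2 : (1 : ℝ) ≤ N := by rw [hN]; push_cast; linarith [Nat.cast_nonneg (α := ℝ) ⌈C⌉₊]
    exact h1.trans (le_self_pow₀ h2 (by omega))
  have hkN : k.natAbs ≤ (N * n) ^ i := by
    have : |(k : ℝ)| ≤ (((N * n) ^ i : ℕ) : ℝ) := by
      refine hk.trans ?_
      push_cast
      rw [mul_pow]
      gcongr
    rw [← Int.cast_abs, Int.abs_eq_natAbs] at this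
    exact_mod_cast this
  obtain ⟨b, hb, e⟩ := hK (N * n) (Nat.mul_pos (by omega) hn) _ hkN
  rw [← mul_assoc] at hb
  rcases k.natAbs_eq with h | h
  · exact ⟨b, hb, by rw [e, h, zpow_natCast, Int.natAbs_natCast]⟩
  · refine ⟨b⁻¹, inv_mem_wordBall hb, ?_⟩
    rw [QuotientGroup.mk_inv, e, h, zpow_neg, zpow_natCast, Int.natAbs_neg, Int.natAbs_natCast]

variable [Group.IsNilpotent G]

/-- Elements of bounded cost at scale `n` have word length `O(n)`. -/
theorem exists_mem_wordBall_of_rep (hF : Subgroup.closure F = ⊤) (hfin : F.Finite)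
    {j : ℕ} (hj : 1 ≤ j) {C : ℝ} (hC : 0 ≤ C) :
    ∃ K : ℕ, ∀ n : ℕ, 1 ≤ n → ∀ g, Rep n (letters F j) C g → g ∈ wordBall F (K * n) := by
  obtain ⟨d, hd⟩ := exists_lcs_add_eq_bot (G := G) j
  induction d generalizing j C with
  | zero =>
    refine ⟨0, fun n _ g hg => ?_⟩
    have := rep_letters_mem_lcs hj hg
    rw [add_zero] at hd
    rw [hd, Subgroup.mem_bot] at this
    rw [this]
    exact one_mem_wordBall _
  | succ d ih =>
    have ih' : ∀ {C : ℝ}, 0 ≤ C → _ := fun {C} hC => ih (j := j + 1) (by omega) (C := C) hC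
      (by rwa [show j + 1 + d = j + (d + 1) by omega])
    suffices H : ∀ l : Set G, l.Finite → l ⊆ lcs G j → ∀ C : ℝ, 0 ≤ C → ∃ K : ℕ, ∀ n : ℕ, 1 ≤ n →
        ∀ g, Rep n (lettersWith F j l) C g → g ∈ wordBall F (K * n) by
      rw [letters_eq]
      exact H _ (gens_finite hfin j) (gens_subset F hj) C hC
    intro l hl
    induction l, hl using Set.Finite.induction_on with
    | empty =>
      intro _ C hC
      rw [lettersWith_empty]
      exact ih' hC
    | @insert t l _ hl ihl =>
      intro hlj C hC
      have ht : t ∈ lcs G j := hlj (Set.mem_insert _ _)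
      have hl' : l ⊆ lcs G j := (Set.subset_insert _ _).trans hlj
      obtain ⟨K₁, hK₁, h₁⟩ := exists_zpow_mul_of_rep_insert hF hfin hj ht hl hl' hC
      obtain ⟨K₂, h₂⟩ := ihl hl' K₁ hK₁
      obtain ⟨K₃, h₃⟩ := exists_wordBall_eq_zpow hF hj ht C
      obtain ⟨K₄, hK₄, h₄⟩ := exists_rep_of_mem_lcs hF hj ht
      obtain ⟨K₅, hK₅, h₅⟩ := exists_rep_letters_of_mem_lcs hF hfin (show 1 ≤ j + 1 by omega)
        (C := K₃ + C * K₄) (by positivity)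
      obtain ⟨K₆, h₆⟩ := ih' hK₅
      refine ⟨K₃ + K₆ + K₂, fun n hn g hg => ?_⟩
      have hn' : (0 : ℝ) < n := by exact_mod_cast hn
      obtain ⟨k, g', rfl, hk, hg'⟩ := h₁ n hn g hg
      obtain ⟨b, hb, e⟩ := h₃ n hn k hk
      -- The short word `b` replaces `t ^ k` up to an error in `G_{j+1}`. The error has bounded cost
      -- in all letters, hence in those of weight above `j`, and the outer induction makes it short.
      have hbt : b⁻¹ * t ^ k ∈ lcs G (j + 1) := QuotientGroup.eq.1 e
      have hrep : Rep n (letters F 1) (K₃ + C * K₄) (b⁻¹ * t ^ k) := by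
        refine ((rep_of_mem_wordBall hb n).inv.mono ?_).mul
          ((((h₄ n hn).mono_set (letters_anti F hj)).zpow k).mono ?_)
        · push_cast
          field_simp
          rfl
        · simpa using cost_le (i := 0) hn hK₄ hk
      have h := h₆ n hn _ (h₅ n hn _ hbt hrep)
      have := mul_mem_wordBall (mul_mem_wordBall hb h) (h₂ n hn g' hg')
      rwa [mul_inv_cancel_left, ← add_mul, ← add_mul] at this

end WordBall

/-! ### Counting in finitely generated abelian groups. -/

section Abelian

/-- `N` is a common denominator of the values on a finite generating set. -/
theorem exists_smul_eq_intCast {A : Type*} [AddCommGroup A] [Module.Finite ℤ A] (g : A →ₗ[ℤ] ℚ) :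
    ∃ (N : ℤ) (ψ : A →ₗ[ℤ] ℤ), N ≠ 0 ∧ ∀ a, (ψ a : ℚ) = N * g a := by
  classical
  obtain ⟨s, hs⟩ := Module.Finite.fg_top (R := ℤ) (M := A)
  obtain ⟨N, hN⟩ := IsLocalization.exist_integer_multiples_of_finset (nonZeroDivisors ℤ)
    (s.image g)
  have h : ∀ a : A, ∃ z : ℤ, (z : ℚ) = (N : ℤ) * g a := by
    intro a
    have ha : a ∈ Submodule.span ℤ (s : Set A) := hs ▸ Submodule.mem_top
    induction ha using Submodule.span_induction with
    | mem x hx =>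
      obtain ⟨z, hz⟩ := hN (g x) (Finset.mem_image_of_mem g hx)
      exact ⟨z, by simpa [Algebra.smul_def] using hz⟩
    | zero => exact ⟨0, by simp⟩
    | add x y _ _ hx hy =>
      obtain ⟨z, hz⟩ := hx
      obtain ⟨w, hw⟩ := hy
      exact ⟨z + w, by rw [map_add, mul_add, ← hz, ← hw]; push_cast; rfl⟩
    | smul c x _ hx =>
      obtain ⟨z, hz⟩ := hx
      refine ⟨c * z, ?_⟩
      rw [map_smul, zsmul_eq_mul, Int.cast_mul, hz]
      ring
  choose ψ hψ using h
  refine ⟨N, (AddMonoidHom.mk' ψ fun a b => ?_).toIntLinearMap, nonZeroDivisors.ne_zero N.2, hψ⟩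
  have : ((ψ (a + b) : ℤ) : ℚ) = (ψ a + ψ b : ℤ) := by
    push_cast
    rw [hψ, hψ, hψ, map_add, mul_add]
  exact_mod_cast this

/-- A subgroup `B` of rank `d` of a finitely generated abelian group `A` is separated, up to a
finite group, by `d` homomorphisms `A → ℤ`. -/
theorem exists_linearMap_finite_ker {A B : Type*} [AddCommGroup A] [AddCommGroup B]
    [Module.Finite ℤ A] [Module.Finite ℤ B] (ι : B →ₗ[ℤ] A) (hι : Function.Injective ι) :
    ∃ ψ : A →ₗ[ℤ] (Fin (Module.finrank ℤ B) → ℤ), {b : B | ψ (ι b) = 0}.Finite := by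
  set T := Submodule.torsion ℤ B with hT
  have hrank : Module.finrank ℤ (B ⧸ T) = Module.finrank ℤ B := by
    rw [← finrank_quotient_torsion_eq (M := B), ← Submodule.torsion_int]
    rfl
  let e := (Module.finBasisOfFinrankEq ℤ (B ⧸ T) hrank).equivFun
  have hex : ∀ i, ∃ (N : ℤ) (ψ : A →ₗ[ℤ] ℤ), N ≠ 0 ∧
      ∀ b, ψ (ι b) = N * e (T.mkQ b) i := by
    intro i
    -- A coordinate of `B` modulo torsion need not extend to `A` over `ℤ`; it extends over the
    -- injective module `ℚ`, and denominators are then cleared.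
    obtain ⟨g, hg⟩ := (Module.Baer.of_divisible ℚ).extension_property ι hι
      ((Int.castAddHom ℚ).toIntLinearMap ∘ₗ LinearMap.proj i ∘ₗ e.toLinearMap ∘ₗ T.mkQ)
    obtain ⟨N, ψ, hN, hψ⟩ := exists_smul_eq_intCast g
    refine ⟨N, ψ, hN, fun b => ?_⟩
    have h1 : g (ι b) = (e (T.mkQ b) i : ℚ) := LinearMap.congr_fun hg b
    have h2 := hψ (ι b)
    rw [h1] at h2
    exact_mod_cast h2
  choose N ψ hN hψ using hex
  refine ⟨LinearMap.pi ψ, ?_⟩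
  have hfin : Finite T := Module.finite_of_fg_torsion T Submodule.torsion_isTorsion
  refine (Set.toFinite (T : Set B)).subset fun b hb => ?_
  have h0 : e (T.mkQ b) = 0 := by
    ext i
    have := congrFun hb i
    rw [LinearMap.pi_apply, hψ] at this
    simpa [hN i] using this
  rw [map_eq_zero_iff e e.injective, Submodule.mkQ_apply, Submodule.Quotient.mk_eq_zero] at h0
  exact h0

theorem ncard_le_mul_ncard_image {α β : Type*} {S : Set α} (hS : S.Finite) (f : α → β) (m : ℕ)
    (h : ∀ a ∈ S, {x ∈ S | f x = f a}.ncard ≤ m) : S.ncard ≤ m * (f '' S).ncard := by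
  classical
  rw [Set.ncard_eq_toFinset_card S hS, Set.ncard_eq_toFinset_card _ (hS.image f),
    Set.Finite.toFinset_image f hS]
  refine Finset.card_le_mul_card_image _ _ fun b hb => ?_
  obtain ⟨a, ha, rfl⟩ := Finset.mem_image.1 hb
  rw [← Set.ncard_coe_finset]
  refine le_trans (le_of_eq ?_) (h a ((Set.Finite.mem_toFinset hS).1 ha))
  congr 1
  ext x
  simp

theorem ncard_pi_le {d : ℕ} {S : Set (Fin d → ℤ)} {R : ℕ} (h : ∀ x ∈ S, ∀ i, |x i| ≤ R) :
    S.ncard ≤ (2 * R + 1) ^ d := by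
  have hsub : S ⊆ (Finset.Icc (fun _ => -(R : ℤ)) (fun _ => (R : ℤ)) : Finset (Fin d → ℤ)) := by
    intro x hx
    rw [Finset.mem_coe, Finset.mem_Icc]
    exact ⟨fun i => (abs_le.1 (h x hx i)).1, fun i => (abs_le.1 (h x hx i)).2⟩
  refine (Set.ncard_le_ncard hsub (Finset.finite_toSet _)).trans (le_of_eq ?_)
  rw [Set.ncard_coe_finset, Pi.card_Icc]
  simp only [Int.card_Icc, Finset.prod_const, Finset.card_univ, Fintype.card_fin]
  congr 1
  omega

/-- The image lies in a box of `(2 * R + 1) ^ d` points, and each fibre is a translate of part of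
the finite kernel. -/
theorem exists_ncard_le {A B : Type*} [AddCommGroup A] [AddCommGroup B]
    [Module.Finite ℤ B] (ι : B →ₗ[ℤ] A) {d : ℕ}
    (ψ : A →ₗ[ℤ] (Fin d → ℤ)) (hψ : {b : B | ψ (ι b) = 0}.Finite) :
    ∃ M : ℕ, ∀ (R : ℕ) (S : Set B), S.Finite → (∀ b ∈ S, ∀ i, |ψ (ι b) i| ≤ R) →
      S.ncard ≤ M * (2 * R + 1) ^ d := by
  refine ⟨{b : B | ψ (ι b) = 0}.ncard, fun R S hS h => ?_⟩
  refine (ncard_le_mul_ncard_image hS (fun b => ψ (ι b)) _ fun a _ => ?_).trans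
    (Nat.mul_le_mul_left _ (ncard_pi_le ?_))
  · refine Set.ncard_le_ncard_of_injOn (fun x => x - a) (fun x hx => ?_)
      (fun x _ y _ hxy => sub_left_injective hxy) hψ
    have := hx.2
    simp only [Set.mem_ofPred_eq, map_sub] at this ⊢
    rw [this, sub_self]
  · rintro _ ⟨b, hb, rfl⟩ i
    exact h b hb i

end Abelian

/-! ### Upper bound for the growth of a subgroup. -/

section Counting

variable {G : Type*} [Group G] {F : Set G}

theorem lcsMap_eq_one_iff {j : ℕ} (x : lcs G j) : lcsMap G j x = 1 ↔ (x : G) ∈ lcs G (j + 1) := by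
  rw [lcsMap, QuotientGroup.mk'_apply, QuotientGroup.eq_one_iff, Subgroup.mem_subgroupOf]

/-- A homomorphism `G_j → ℤ` killing `G_{j+1}` grows at most like `n ^ j` on elements of bounded
cost. -/
theorem exists_abs_le_of_rep (hfin : F.Finite) {j : ℕ} (hj : 1 ≤ j)
    (φ : Additive (LcsQuot G j) →+ ℤ) :
    ∃ K : ℕ, ∀ n : ℕ, 1 ≤ n → ∀ (c : ℝ) (g : G) (hg : g ∈ lcs G j), Rep n (letters F j) c g →
      |(φ (Additive.ofMul (lcsMap G j ⟨g, hg⟩)) : ℝ)| ≤ K * (c * (n : ℝ) ^ j) := by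
  classical
  -- Extension by zero lets the induction on words run without carrying proofs of membership in
  -- `G_j`.
  let v : G → ℝ := fun g => if hg : g ∈ lcs G j then
    |(φ (Additive.ofMul (lcsMap G j ⟨g, hg⟩)) : ℝ)| else 0
  obtain ⟨M, hM⟩ := ((gens_finite hfin j).image v).bddAbove
  obtain ⟨K, hK⟩ := exists_nat_ge M
  refine ⟨K, fun n hn c g hg hrep => ?_⟩
  have hn' : (0 : ℝ) < n := by exact_mod_cast hn
  have hmul : ∀ x y : G, x ∈ lcs G j → y ∈ lcs G j → v (x * y) ≤ v x + v y := by
    intro x y hx hy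
    have e : (⟨x * y, mul_mem hx hy⟩ : lcs G j) = ⟨x, hx⟩ * ⟨y, hy⟩ := rfl
    simp only [v, dif_pos hx, dif_pos hy, dif_pos (mul_mem hx hy), e, map_mul, ofMul_mul, map_add,
      Int.cast_add]
    exact abs_add_le _ _
  have hinv : ∀ x : G, x ∈ lcs G j → v x⁻¹ = v x := by
    intro x hx
    have e : (⟨x⁻¹, inv_mem hx⟩ : lcs G j) = ⟨x, hx⟩⁻¹ := rfl
    simp only [v, dif_pos hx, dif_pos (inv_mem hx), e, map_inv, ofMul_inv, map_neg,
      Int.cast_neg, abs_neg]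
  have hletter : ∀ p ∈ letters F j, p.1 ∈ lcs G j ∧
      v p.1 ≤ K * (((n : ℝ) ^ p.2)⁻¹ * (n : ℝ) ^ j) := by
    intro p hp
    have hpj : p.1 ∈ lcs G j := lcs_antitone hp.1 (letters_subset_lcs F hj hp)
    refine ⟨hpj, ?_⟩
    -- Only the finitely many letters of weight exactly `j` contribute; heavier ones lie in
    -- `G_{j+1}`.
    rcases hp.1.eq_or_lt with h | h
    · rw [← h, inv_mul_cancel₀ (by positivity), mul_one]
      have := hp.2
      rw [← h] at this
      exact (hM ⟨p.1, this, rfl⟩).trans hK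
    · have h0 := (lcsMap_eq_one_iff ⟨p.1, hpj⟩).2 (lcs_antitone h (letters_subset_lcs F hj hp))
      simp only [v, dif_pos hpj, h0, ofMul_one, map_zero, Int.cast_zero, abs_zero]
      positivity
  have key : v g ≤ K * (c * (n : ℝ) ^ j) := by
    clear hg
    induction hrep with
    | one hc =>
      have h0 := (lcsMap_eq_one_iff (⟨1, one_mem _⟩ : lcs G j)).2 (one_mem _)
      simp only [v, dif_pos (one_mem (lcs G j)), h0, ofMul_one, map_zero, Int.cast_zero, abs_zero]
      positivity
    | @cons c d g p hp hg h ih =>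
      obtain ⟨h1, h2⟩ := hletter p hp
      calc v (p.1 * g) ≤ v p.1 + v g := hmul _ _ h1 (rep_letters_mem_lcs hj hg)
        _ ≤ K * ((c + ((n : ℝ) ^ p.2)⁻¹) * (n : ℝ) ^ j) := by linarith
        _ ≤ _ := by gcongr
    | @cons_inv c d g p hp hg h ih =>
      obtain ⟨h1, h2⟩ := hletter p hp
      calc v (p.1⁻¹ * g) ≤ v p.1⁻¹ + v g := hmul _ _ (inv_mem h1) (rep_letters_mem_lcs hj hg)
        _ = v p.1 + v g := by rw [hinv _ h1]
        _ ≤ K * ((c + ((n : ℝ) ^ p.2)⁻¹) * (n : ℝ) ^ j) := by linarith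
        _ ≤ _ := by gcongr
  simpa only [v, dif_pos hg] using key

variable [Group.IsNilpotent G]

theorem lcsQuot_finite (hF : Subgroup.closure F = ⊤) (hfin : F.Finite) {j : ℕ} (hj : 1 ≤ j) :
    Module.Finite ℤ (Additive (LcsQuot G j)) := by
  have h1 : Subgroup.FG (lcs G j) := by
    refine (Subgroup.fg_iff _).2 ⟨Prod.fst '' letters F j, ?_, (letters_finite hfin hj).image _⟩
    refine le_antisymm ((Subgroup.closure_le _).2 ?_) (closure_letters hF hj)
    rintro _ ⟨p, hp, rfl⟩
    exact lcs_antitone hp.1 (letters_subset_lcs F hj hp)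
  have h2 : Group.FG (lcs G j) := (Group.fg_iff_subgroup_fg _).2 h1
  have h3 : Group.FG (LcsQuot G j) := QuotientGroup.fg _
  exact Module.Finite.iff_addGroup_fg.2 inferInstance

/-- The elements of `H` of cost at most `C` in letters of weight at least `j`. -/
def repSet (F : Set G) (H : Subgroup G) (j n : ℕ) (C : ℝ) : Set G :=
  {g | g ∈ H ∧ Rep n (letters F j) C g}

theorem repSet_finite (hF : Subgroup.closure F = ⊤) (hfin : F.Finite) (H : Subgroup G) {j n : ℕ}
    (hj : 1 ≤ j) (hn : 1 ≤ n) (C : ℝ) : (repSet F H j n C).Finite := by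
  by_cases hC : 0 ≤ C
  · obtain ⟨K, hK⟩ := exists_mem_wordBall_of_rep hF hfin hj hC
    exact (wordBall_finite hfin (K * n)).subset fun g hg => hK n hn g hg.2
  · refine Set.finite_empty.subset fun g hg => hC hg.2.nonneg

/-- The image of `H ∩ G_j` in `G_j / G_{j+1}`. -/
abbrev relImage (H : Subgroup G) (j : ℕ) : Subgroup (LcsQuot G j) :=
  (H.subgroupOf (lcs G j)).map (lcsMap G j)

theorem exists_ncard_image_le (hF : Subgroup.closure F = ⊤) (hfin : F.Finite) (H : Subgroup G)
    {j : ℕ} (hj : 1 ≤ j) {C : ℝ} (hC : 0 ≤ C) :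
    ∃ K : ℕ, ∀ n : ℕ, 1 ≤ n →
      (lcsMap G j '' {x : lcs G j | (x : G) ∈ repSet F H j n C}).ncard ≤
        K * n ^ (j * relRank H j) := by
  have := lcsQuot_finite hF hfin hj
  let ι : Additive (relImage H j) →ₗ[ℤ] Additive (LcsQuot G j) :=
    (MonoidHom.toAdditive (relImage H j).subtype).toIntLinearMap
  have hι : Function.Injective ι := Subtype.coe_injective
  have : Module.Finite ℤ (Additive (relImage H j)) := Module.Finite.of_injective ι hι
  -- The coordinates must be defined on all of `G_j / G_{j+1}`: the letters in a word for an element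
  -- of `H` need not lie in `H`.
  obtain ⟨ψ, hψ⟩ := exists_linearMap_finite_ker ι hι
  obtain ⟨M, hM⟩ := exists_ncard_le ι ψ hψ
  choose K hK using fun i => exists_abs_le_of_rep hfin hj
    ((LinearMap.proj i ∘ₗ ψ).toAddMonoidHom : Additive (LcsQuot G j) →+ ℤ)
  set K' := (∑ i, K i) * ⌈C⌉₊ with hK'
  refine ⟨M * (2 * K' + 1) ^ relRank H j, fun n hn => ?_⟩
  have hn' : (0 : ℝ) < n := by exact_mod_cast hn
  set S := lcsMap G j '' {x : lcs G j | (x : G) ∈ repSet F H j n C} with hS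
  have hSfin : S.Finite := ((repSet_finite hF hfin H hj hn C).preimage
    Subtype.coe_injective.injOn).image _
  have hSle : S ⊆ relImage H j := by
    rintro _ ⟨x, hx, rfl⟩
    exact ⟨x, hx.1, rfl⟩
  let S' : Set (Additive (relImage H j)) := {b | Additive.toMul (ι b) ∈ S}
  have hS' : S.ncard = S'.ncard := by
    refine (Set.ncard_congr (fun b _ => Additive.toMul (ι b)) (fun b hb => hb)
      (fun a b _ _ h => hι h) fun s hs => ⟨Additive.ofMul ⟨s, hSle hs⟩, hs, rfl⟩).symm
  have hS'fin : S'.Finite := hSfin.preimage (hι.injOn)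
  rw [hS']
  refine (hM (K' * n ^ j) S' hS'fin ?_).trans ?_
  · rintro b ⟨x, hx, hxb⟩ i
    have h1 := hK i n hn C x x.2 hx.2
    have e : Additive.ofMul (lcsMap G j ⟨x, x.2⟩) = ι b := by
      rw [Subtype.coe_eta, hxb]; rfl
    rw [e] at h1
    have h2 : |(ψ (ι b) i : ℝ)| ≤ ((K' * n ^ j : ℕ) : ℝ) := by
      refine (le_of_eq rfl).trans (h1.trans ?_)
      rw [hK']
      push_cast
      rw [mul_assoc]
      have hKi : (K i : ℝ) ≤ ∑ i, (K i : ℝ) :=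
        Finset.single_le_sum (f := fun i => (K i : ℝ)) (fun _ _ => Nat.cast_nonneg _)
          (Finset.mem_univ i)
      gcongr
      exact Nat.le_ceil C
    exact_mod_cast h2
  · have h1 : 2 * (K' * n ^ j) + 1 ≤ (2 * K' + 1) * n ^ j := by
      have : 1 ≤ n ^ j := Nat.one_le_pow _ _ hn
      nlinarith
    calc M * (2 * (K' * n ^ j) + 1) ^ relRank H j
        ≤ M * ((2 * K' + 1) * n ^ j) ^ relRank H j := by gcongr
      _ = _ := by rw [mul_pow, pow_mul]; ring

/-- Two elements with the same image differ by an element of `H ∩ G_{j+1}` of cost at most `2 * C`,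
which is rewritten in heavier letters. Fibres are thus counted by the next layer. -/
theorem exists_ncard_repSet_le (hF : Subgroup.closure F = ⊤) (hfin : F.Finite) (H : Subgroup G)
    {j d : ℕ} (hj : 1 ≤ j) (hd : lcs G (j + d) = ⊥) {C : ℝ} (hC : 0 ≤ C) :
    ∃ K : ℕ, ∀ n : ℕ, 1 ≤ n →
      (repSet F H j n C).ncard ≤ K * n ^ ∑ i ∈ Finset.Ico j (j + d), i * relRank H i := by
  induction d generalizing j C with
  | zero =>
    refine ⟨1, fun n hn => ?_⟩
    rw [add_zero] at hd
    have : repSet F H j n C ⊆ {1} := fun g hg => by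
      have := rep_letters_mem_lcs hj hg.2
      rwa [hd, Subgroup.mem_bot] at this
    simpa using Set.ncard_le_ncard this
  | succ d ih =>
    obtain ⟨K₁, h₁⟩ := exists_ncard_image_le hF hfin H hj hC
    obtain ⟨K₂, hK₂, h₂⟩ := exists_rep_letters_succ hF hfin hj (C := C + C) (by positivity)
    obtain ⟨K₃, h₃⟩ := ih (j := j + 1) (by omega) (by rwa [show j + 1 + d = j + (d + 1) by omega])
      hK₂
    refine ⟨K₃ * K₁, fun n hn => ?_⟩
    set S : Set (lcs G j) := {x | (x : G) ∈ repSet F H j n C} with hS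
    have hSfin : S.Finite := (repSet_finite hF hfin H hj hn C).preimage
      Subtype.coe_injective.injOn
    have hcard : (repSet F H j n C).ncard = S.ncard := by
      refine (Set.ncard_congr (fun (x : lcs G j) _ => (x : G)) (fun b hb => hb)
        (fun a b _ _ h => Subtype.ext h)
        fun s hs => ⟨⟨s, rep_letters_mem_lcs hj hs.2⟩, hs, rfl⟩).symm
    rw [hcard, Finset.sum_eq_sum_Ico_succ_bot (by omega), pow_add]
    rw [show j + (d + 1) = j + 1 + d by omega]
    calc S.ncard ≤ (K₃ * n ^ ∑ i ∈ Finset.Ico (j + 1) (j + 1 + d), i * relRank H i) *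
          (lcsMap G j '' S).ncard := by
          refine ncard_le_mul_ncard_image hSfin _ _ fun a ha => ?_
          refine le_trans (Set.ncard_le_ncard_of_injOn (fun x : lcs G j => (a : G)⁻¹ * x) ?_ ?_
            (repSet_finite hF hfin H (by omega) hn K₂)) (h₃ n hn)
          · rintro x ⟨hx, hxa⟩
            refine ⟨H.mul_mem (H.inv_mem ha.1) hx.1, h₂ n hn _ ?_ (ha.2.inv.mul hx.2)⟩
            have : lcsMap G j (a⁻¹ * x) = 1 := by rw [map_mul, map_inv, hxa, inv_mul_cancel]
            exact (lcsMap_eq_one_iff _).1 this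
          · exact fun x _ y _ h => Subtype.ext (mul_left_cancel h)
      _ ≤ (K₃ * n ^ ∑ i ∈ Finset.Ico (j + 1) (j + 1 + d), i * relRank H i) *
          (K₁ * n ^ (j * relRank H j)) := Nat.mul_le_mul_left _ (h₁ n hn)
      _ = _ := by ring

end Counting

/-! ### Lower bound for the growth of a subgroup. -/

section LowerBound

variable {G : Type*} [Group G] {F : Set G}

theorem Rep.list_prod {n : ℕ} {S : Set (G × ℕ)} {c : ℝ} (l : List G)
    (h : ∀ x ∈ l, Rep n S c x) : Rep n S (l.length * c) l.prod := by
  induction l with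
  | nil => exact Rep.one (by simp)
  | cons x l ih =>
    rw [List.prod_cons]
    refine ((h x (by simp)).mul (ih fun y hy => h y (by simp [hy]))).mono (le_of_eq ?_)
    rw [List.length_cons]
    push_cast
    ring

theorem exists_linearIndependent_relImage (H : Subgroup G) (j : ℕ) :
    ∃ h : Fin (relRank H j) → lcs G j, (∀ i, (h i : G) ∈ H) ∧
      ∀ k : Fin (relRank H j) → ℤ, ∏ i, lcsMap G j (h i) ^ k i = 1 → k = 0 := by
  obtain ⟨f, hf⟩ := exists_linearIndependent_of_le_finrank (R := ℤ)
    (M := Additive (relImage H j)) (n := relRank H j) le_rfl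
  have hex : ∀ i, ∃ x : lcs G j, (x : G) ∈ H ∧ lcsMap G j x = (f i).toMul := by
    intro i
    obtain ⟨x, hx, e⟩ := (f i).toMul.2
    exact ⟨x, hx, e⟩
  choose h hH he using hex
  refine ⟨h, hH, fun k hk => funext fun i => ?_⟩
  refine Fintype.linearIndependent_iff.1 hf k ?_ i
  apply Additive.toMul.injective
  apply Subtype.ext
  simp only [he] at hk
  rw [toMul_sum, toMul_zero, Subgroup.coe_one, ← hk]
  simp

variable [Group.IsNilpotent G]

/-- Independent elements of the image of `H ∩ G_j`, lifted to `H`, are raised to exponents below `n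
^ j` and multiplied by bounded-cost elements of the next layer. The image in `G_j / G_{j+1}`
recovers the exponents, and then the other factor. -/
theorem exists_le_ncard_repSet (hF : Subgroup.closure F = ⊤) (hfin : F.Finite) (H : Subgroup G)
    {j d : ℕ} (hj : 1 ≤ j) (hd : lcs G (j + d) = ⊥) :
    ∃ C : ℝ, 0 ≤ C ∧ ∀ n : ℕ, 1 ≤ n →
      n ^ ∑ i ∈ Finset.Ico j (j + d), i * relRank H i ≤ (repSet F H j n C).ncard := by
  induction d generalizing j with
  | zero =>
    refine ⟨0, le_rfl, fun n hn => ?_⟩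
    rw [add_zero, Finset.Ico_self, Finset.sum_empty, pow_zero, Nat.one_le_iff_ne_zero]
    exact Set.ncard_ne_zero_of_mem (a := 1) ⟨H.one_mem, Rep.one le_rfl⟩
      (repSet_finite hF hfin H hj hn 0)
  | succ d ih =>
    obtain ⟨C₁, hC₁, h₁⟩ := ih (j := j + 1) (by omega)
      (by rwa [show j + 1 + d = j + (d + 1) by omega])
    obtain ⟨h, hH, hind⟩ := exists_linearIndependent_relImage H j
    choose K hK hrep using fun i => exists_rep_of_mem_lcs hF hj (h i).2
    set C₂ := relRank H j * ∑ i, K i with hC₂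
    have hK0 : 0 ≤ ∑ i, K i := Finset.sum_nonneg fun i _ => hK i
    refine ⟨C₂ + C₁, by positivity, fun n hn => ?_⟩
    have hn' : (0 : ℝ) < n := by exact_mod_cast hn
    let P : (Fin (relRank H j) → Fin (n ^ j)) → lcs G j := fun k =>
      (List.ofFn fun i => h i ^ (k i : ℕ)).prod
    have hPmap : ∀ k, lcsMap G j (P k) = ∏ i, lcsMap G j (h i) ^ (k i : ℕ) := by
      intro k
      simp only [P, map_list_prod, List.map_ofFn, List.prod_ofFn, Function.comp_def, map_pow]
    have hPH : ∀ k, (P k : G) ∈ H := by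
      intro k
      refine Subgroup.mem_subgroupOf.1 (Subgroup.list_prod_mem (H.subgroupOf (lcs G j)) ?_)
      intro x hx
      obtain ⟨i, rfl⟩ := List.mem_ofFn.1 hx
      exact Subgroup.pow_mem _ (hH i) _
    have hPrep : ∀ k, Rep n (letters F j) C₂ (P k : G) := by
      intro k
      have e : (P k : G) = (List.ofFn fun i => (h i : G) ^ (k i : ℕ)).prod := by
        have := map_list_prod (lcs G j).subtype (List.ofFn fun i => h i ^ (k i : ℕ))
        rw [List.map_ofFn] at this
        exact this
      rw [e]
      refine (Rep.list_prod _ (c := ∑ i, K i) fun x hx => ?_).mono (by rw [List.length_ofFn])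
      obtain ⟨i, rfl⟩ := List.mem_ofFn.1 hx
      refine ((hrep i n hn).pow (k i)).mono ?_
      have hk : ((k i : ℕ) : ℝ) ≤ 1 * (n : ℝ) ^ j := by
        rw [one_mul]
        exact_mod_cast (k i).2.le
      refine le_trans (by simpa using cost_le (i := 0) hn (hK i) hk) ?_
      exact Finset.single_le_sum (f := K) (fun i _ => hK i) (Finset.mem_univ i)
    have hinj : ∀ k k', lcsMap G j (P k) = lcsMap G j (P k') → k = k' := by
      intro k k' e
      rw [hPmap, hPmap] at e
      have h0 := hind (fun i => (k i : ℤ) - (k' i : ℤ)) (by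
        simp only [zpow_sub, zpow_natCast]
        rw [Finset.prod_mul_distrib, e, Finset.prod_inv_distrib, mul_inv_cancel])
      funext i
      have := congrFun h0 i
      simp only [Pi.zero_apply] at this
      exact Fin.ext (by omega)
    rw [Finset.sum_eq_sum_Ico_succ_bot (by omega), pow_add]
    rw [show j + (d + 1) = j + 1 + d by omega]
    calc n ^ (j * relRank H j) * n ^ ∑ i ∈ Finset.Ico (j + 1) (j + 1 + d), i * relRank H i
        ≤ (Set.univ : Set (Fin (relRank H j) → Fin (n ^ j))).ncard *
            (repSet F H (j + 1) n C₁).ncard := by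
          rw [Set.ncard_univ, Nat.card_eq_fintype_card, Fintype.card_fun, Fintype.card_fin,
            Fintype.card_fin, ← pow_mul]
          exact Nat.mul_le_mul_left _ (h₁ n hn)
      _ = (Set.univ ×ˢ repSet F H (j + 1) n C₁).ncard := Set.ncard_prod.symm
      _ ≤ _ := by
          refine Set.ncard_le_ncard_of_injOn (fun q => (P q.1 : G) * q.2) ?_ ?_
            (repSet_finite hF hfin H hj hn _)
          · rintro ⟨k, y⟩ ⟨-, hy⟩
            exact ⟨H.mul_mem (hPH k) hy.1,
              (hPrep k).mul (hy.2.mono_set (letters_anti F (Nat.le_succ j)))⟩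
          · rintro ⟨k, y⟩ ⟨-, hy⟩ ⟨k', y'⟩ ⟨-, hy'⟩ e
            have hmem : ∀ y ∈ repSet F H (j + 1) n C₁, y ∈ lcs G (j + 1) := fun y hy =>
              rep_letters_mem_lcs (by omega) hy.2
            simp only at e
            have e1 : ((P k')⁻¹ * P k : lcs G j) = (y' * y⁻¹ : G) := by
              push_cast
              rw [inv_mul_eq_iff_eq_mul, ← mul_assoc, eq_mul_inv_iff_mul_eq, e]
            have h0 := (lcsMap_eq_one_iff ((P k')⁻¹ * P k)).2
              (e1 ▸ mul_mem (hmem y' hy') (inv_mem (hmem y hy)))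
            rw [map_mul, map_inv, inv_mul_eq_one] at h0
            obtain rfl := hinj _ _ h0
            rw [mul_left_cancel e]

end LowerBound

/-! ### Graph balls, word balls and coset counting. -/

section Balls

variable {G : Type*} [Group G] {F : Set G}

theorem ball_eq_image_wordBall {X : Type*} [MulAction G X] (x : X) (n : ℕ) :
    ball F x n = (fun g : G => g • x) '' wordBall F n := by
  have hadj : ∀ a ∈ F, ∀ y : X, (schreierGraph F X).edist y (a • y) ≤ 1 := by
    intro a ha y
    -- The simple graph has no loops, so a generator fixing `y` gives distance 0 instead of an edge.
    by_cases h : y = a • y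
    · rw [← h, SimpleGraph.edist_self]; exact zero_le
    · have : (schreierGraph F X).Adj y (a • y) :=
        (SimpleGraph.fromRel_adj _ _ _).2 ⟨h, Or.inl ⟨a, ha, rfl⟩⟩
      exact (SimpleGraph.edist_eq_one_iff_adj.2 this).le
  apply Set.Subset.antisymm
  · intro y hy
    have hy : (schreierGraph F X).edist x y ≤ n := hy
    obtain ⟨p, hp⟩ := SimpleGraph.exists_walk_of_edist_ne_top
      (ne_top_of_le_ne_top (ENat.natCast_ne_top n) hy)
    rw [← hp, Nat.cast_le] at hy
    suffices H : ∀ {x y : X} (p : (schreierGraph F X).Walk x y),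
        ∃ g ∈ wordBall F p.length, g • x = y by
      obtain ⟨g, hg, e⟩ := H p
      exact ⟨g, wordBall_mono hy hg, e⟩
    intro x y p
    induction p with
    | nil => exact ⟨1, one_mem_wordBall _, one_smul _ _⟩
    | @cons u v w h p ih =>
      obtain ⟨g, hg, rfl⟩ := ih
      obtain ⟨a, ha, rfl⟩ : ∃ a ∈ wordBall F 1, a • u = v := by
        rw [wordBall, pow_one]
        rcases ((SimpleGraph.fromRel_adj _ _ _).1 h).2 with ⟨a, ha, e⟩ | ⟨a, ha, e⟩
        · exact ⟨a, Or.inl (Or.inl ha), e⟩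
        · exact ⟨a⁻¹, Or.inl (Or.inr (by simpa using ha)), by rw [← e, inv_smul_smul]⟩
      exact ⟨g * a, mul_mem_wordBall hg ha, mul_smul _ _ _⟩
  · rintro _ ⟨g, hg, rfl⟩
    change (schreierGraph F X).edist x (g • x) ≤ n
    induction n generalizing g with
    | zero =>
      obtain rfl : g = 1 := by simpa [wordBall] using hg
      simp
    | succ n ih =>
      rw [wordBall, pow_succ'] at hg
      obtain ⟨a, ha, g, hg, rfl⟩ := hg
      have h1 : (schreierGraph F X).edist (g • x) ((a * g) • x) ≤ 1 := by
        rw [mul_smul]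
        rcases ha with (ha | ha) | rfl
        · exact hadj a ha _
        · have := hadj a⁻¹ ha (a • g • x)
          rwa [inv_smul_smul, SimpleGraph.edist_comm] at this
        · simp
      push_cast
      exact SimpleGraph.edist_triangle.trans (add_le_add (ih g hg) h1)

theorem relGrowth_eq (H : Subgroup G) (n : ℕ) :
    relGrowth F H n = (wordBall F n ∩ (H : Set G)).ncard := by
  rw [relGrowth, ball_eq_image_wordBall]
  simp

theorem cosetGrowth_eq (H : Subgroup G) (n : ℕ) :
    cosetGrowth F H n = ((QuotientGroup.mk : G → G ⧸ H) '' wordBall F n).ncard := by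
  rw [cosetGrowth, ball_eq_image_wordBall]
  simp

/-- Two elements of the ball in the same coset `gH` differ by an element of `H` of length at most `2
* n`. -/
theorem relGrowth_top_le (hfin : F.Finite) (H : Subgroup G) (n : ℕ) :
    relGrowth F ⊤ n ≤ relGrowth F H (2 * n) * cosetGrowth F H n := by
  rw [relGrowth_eq, relGrowth_eq, cosetGrowth_eq, Subgroup.coe_top, Set.inter_univ]
  refine ncard_le_mul_ncard_image (wordBall_finite hfin n) _ _ fun a ha => ?_
  refine Set.ncard_le_ncard_of_injOn (fun x => a⁻¹ * x) ?_ (fun x _ y _ h => mul_left_cancel h)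
    ((wordBall_finite hfin _).inter_of_left _)
  rintro x ⟨hx, hxa⟩
  refine ⟨?_, QuotientGroup.eq.1 hxa.symm⟩
  rw [two_mul]
  exact mul_mem_wordBall (inv_mem_wordBall ha) hx

/-- Multiply a short representative of each coset by the short elements of `H`; the products are
distinct. -/
theorem mul_cosetGrowth_le (hfin : F.Finite) (H : Subgroup G) (n : ℕ) :
    relGrowth F H n * cosetGrowth F H n ≤ relGrowth F ⊤ (2 * n) := by
  rw [relGrowth_eq, relGrowth_eq, cosetGrowth_eq, Subgroup.coe_top, Set.inter_univ, mul_comm,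
    ← Set.ncard_prod]
  have hex : ∀ q ∈ (QuotientGroup.mk : G → G ⧸ H) '' wordBall F n, ∃ g ∈ wordBall F n,
      (g : G ⧸ H) = q := fun q hq => hq
  choose! s hs e using hex
  refine Set.ncard_le_ncard_of_injOn (fun q => s q.1 * q.2) ?_ ?_ (wordBall_finite hfin _)
  · rintro ⟨q, y⟩ ⟨hq, hy⟩
    rw [two_mul]
    exact mul_mem_wordBall (hs q hq) hy.1
  · rintro ⟨q, y⟩ ⟨hq, hy⟩ ⟨q', y'⟩ ⟨hq', hy'⟩ h
    simp only at h hq hy hq' hy'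
    have h1 : q = q' := by
      rw [← e q hq, ← e q' hq', ← QuotientGroup.mk_mul_of_mem (s q) hy.2,
        ← QuotientGroup.mk_mul_of_mem (s q') hy'.2, h]
    subst h1
    rw [mul_left_cancel h]

end Balls

/-! ### From two-sided power bounds to limits and comparability. -/

section Asymptotics

/-- Two-sided bounds by constant multiples of `n ^ D`. -/
def PowerBounded (V : ℕ → ℕ) (D : ℤ) : Prop :=
  ∃ c C : ℝ, 0 < c ∧ 0 < C ∧ ∀ᶠ n : ℕ in atTop,
    c * (n : ℝ) ^ D ≤ V n ∧ (V n : ℝ) ≤ C * (n : ℝ) ^ D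

theorem PowerBounded.comparable {V : ℕ → ℕ} {D : ℤ} (h : PowerBounded V D) :
    Comparable (fun n => (V n : ℝ)) (fun n => (n : ℝ) ^ D) := by
  obtain ⟨c, C, hc, hC, h⟩ := h
  refine ⟨max C (1 / c), lt_max_of_lt_left hC, ?_⟩
  filter_upwards [h, eventually_ge_atTop 1] with n hn hn1
  have hn0 : (0 : ℝ) < n := by exact_mod_cast hn1
  have hpos : (0 : ℝ) < (n : ℝ) ^ D := by positivity
  constructor
  · refine le_trans ?_ ((le_div_iff₀ hpos).2 hn.1)
    rw [one_div_le (lt_max_of_lt_left hC) hc]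
    exact le_max_right _ _
  · exact ((div_le_iff₀ hpos).2 hn.2).trans (le_max_left _ _)

theorem PowerBounded.hasGrowthDegree {V : ℕ → ℕ} {D : ℤ} (h : PowerBounded V D) :
    HasGrowthDegree V (D : ℝ) := by
  obtain ⟨c, C, hc, hC, h⟩ := h
  have hlog : Tendsto (fun n : ℕ => Real.log n) atTop atTop :=
    Real.tendsto_log_atTop.comp tendsto_natCast_atTop_atTop
  have hlim : ∀ a : ℝ, Tendsto (fun n : ℕ => Real.log a / Real.log n + D) atTop (𝓝 (D : ℝ)) := by
    intro a
    simpa using (hlog.const_div_atTop (Real.log a)).add_const (D : ℝ)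
  have hfact : ∀ a : ℝ, 0 < a → ∀ n : ℕ, 2 ≤ n →
      Real.log (a * (n : ℝ) ^ D) / Real.log n = Real.log a / Real.log n + D := by
    intro a ha n hn
    have hn0 : (1 : ℝ) < n := by exact_mod_cast hn
    have hl : Real.log n ≠ 0 := (Real.log_pos hn0).ne'
    rw [Real.log_mul ha.ne' (by positivity), Real.log_zpow, add_div, mul_div_cancel_right₀ _ hl]
  refine tendsto_of_tendsto_of_tendsto_of_le_of_le' (hlim c) (hlim C) ?_ ?_
  · filter_upwards [h, eventually_ge_atTop 2] with n hn hn2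
    have hn0 : (1 : ℝ) < n := by exact_mod_cast hn2
    have hl := Real.log_pos hn0
    rw [← hfact c hc n hn2]
    exact div_le_div_of_nonneg_right (Real.log_le_log (by positivity) hn.1) hl.le
  · filter_upwards [h, eventually_ge_atTop 2] with n hn hn2
    have hn0 : (1 : ℝ) < n := by exact_mod_cast hn2
    have hl := Real.log_pos hn0
    have hV : (0 : ℝ) < V n := lt_of_lt_of_le (by positivity) hn.1
    rw [← hfact C hC n hn2]
    exact div_le_div_of_nonneg_right (Real.log_le_log hV hn.2) hl.le

/-- The lower bound is known only along multiples of `L`; monotonicity fills the gaps, with `n ≤ 2 *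
L * (n / L)` once `n ≥ L`. -/
theorem powerBounded_of_le {V : ℕ → ℕ} (hV : Monotone V) {D K L : ℕ} (hL : 0 < L)
    (h₁ : ∀ n, 1 ≤ n → V n ≤ K * n ^ D) (h₂ : ∀ n, 1 ≤ n → n ^ D ≤ V (L * n)) :
    PowerBounded V D := by
  have hL' : (0 : ℝ) < L := by exact_mod_cast hL
  refine ⟨((2 * L : ℝ) ^ D)⁻¹, K + 1, by positivity, by positivity, ?_⟩
  filter_upwards [eventually_ge_atTop L] with n hn
  have hm : 1 ≤ n / L := (Nat.one_le_div_iff hL).2 hn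
  rw [zpow_natCast]
  constructor
  · have h3 : n ≤ 2 * L * (n / L) := by
      have := Nat.div_add_mod n L
      have := Nat.mod_lt n hL
      have : L ≤ L * (n / L) := Nat.le_mul_of_pos_right _ hm
      nlinarith
    have h4 : n ^ D ≤ (2 * L) ^ D * V n := by
      calc n ^ D ≤ (2 * L * (n / L)) ^ D := by gcongr
        _ = (2 * L) ^ D * (n / L) ^ D := mul_pow _ _ _
        _ ≤ _ := Nat.mul_le_mul_left _ ((h₂ _ hm).trans (hV (Nat.mul_div_le n L)))
    rw [inv_mul_le_iff₀ (by positivity)]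
    exact_mod_cast h4
  · have h3 := h₁ n (hL.trans_le hn)
    have h4 : (V n : ℝ) ≤ K * (n : ℝ) ^ D := by exact_mod_cast h3
    have : (0 : ℝ) ≤ (n : ℝ) ^ D := by positivity
    linarith

theorem powerBounded_quotient {α β γ : ℕ → ℕ} {DG DH : ℕ} (hα : PowerBounded α DG)
    (hβ : PowerBounded β DH) (h₁ : ∀ n, α n ≤ β (2 * n) * γ n)
    (h₂ : ∀ n, β n * γ n ≤ α (2 * n)) : PowerBounded γ ((DG : ℤ) - DH) := by
  obtain ⟨a, A, ha, hA, hα⟩ := hα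
  obtain ⟨b, B, hb, hB, hβ⟩ := hβ
  have htwo : Tendsto (fun n : ℕ => 2 * n) atTop atTop :=
    tendsto_id.const_mul_atTop' two_pos
  refine ⟨a / (B * 2 ^ DH), A * 2 ^ DG / b, by positivity, by positivity, ?_⟩
  filter_upwards [hα, hβ, htwo.eventually hα, htwo.eventually hβ, eventually_ge_atTop 1]
    with n hα hβ hα₂ hβ₂ hn
  have hn0 : (0 : ℝ) < n := by exact_mod_cast hn
  have h₁' : (α n : ℝ) ≤ β (2 * n) * γ n := by exact_mod_cast h₁ n
  have h₂' : (β n : ℝ) * γ n ≤ α (2 * n) := by exact_mod_cast h₂ n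
  simp only [zpow_natCast, Nat.cast_mul, Nat.cast_ofNat, mul_pow] at hα hβ hα₂ hβ₂
  rw [zpow_sub₀ hn0.ne', zpow_natCast, zpow_natCast]
  constructor
  · have h3 : a * (n : ℝ) ^ DG ≤ B * (2 ^ DH * (n : ℝ) ^ DH) * γ n :=
      hα.1.trans (h₁'.trans (mul_le_mul_of_nonneg_right hβ₂.2 (Nat.cast_nonneg _)))
    rw [div_mul_div_comm, div_le_iff₀ (by positivity)]
    linarith
  · have h3 : b * (n : ℝ) ^ DH * γ n ≤ A * (2 ^ DG * (n : ℝ) ^ DG) :=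
      (mul_le_mul_of_nonneg_right hβ.1 (Nat.cast_nonneg _)).trans (h₂'.trans hα₂.2)
    rw [div_mul_div_comm, le_div_iff₀ (by positivity)]
    linarith

end Asymptotics

/-! ### Growth of subgroups and of coset spaces. -/

section Growth

variable {G : Type*} [Group G] {F : Set G}

theorem relGrowth_monotone (hfin : F.Finite) (H : Subgroup G) : Monotone (relGrowth F H) := by
  intro m n h
  rw [relGrowth_eq, relGrowth_eq]
  exact Set.ncard_le_ncard (Set.inter_subset_inter_left _ (wordBall_mono h))
    ((wordBall_finite hfin _).inter_of_left _)

theorem relRank_top (j : ℕ) : relRank (⊤ : Subgroup G) j = lcsRank G j := by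
  have h : ((⊤ : Subgroup G).subgroupOf (lcs G j)).map (lcsMap G j) = ⊤ := by
    rw [Subgroup.top_subgroupOf, ← MonoidHom.range_eq_map, MonoidHom.range_eq_top]
    exact QuotientGroup.mk'_surjective _
  rw [relRank, lcsRank, h]
  exact (MulEquiv.toAdditive (Subgroup.topEquiv (G := LcsQuot G j))).toIntLinearEquiv.finrank_eq

variable [Group.IsNilpotent G]

theorem relDegree_top : relDegree (⊤ : Subgroup G) = degree G := by
  simp only [relDegree, degree, relRank_top]

theorem cosetDegree_eq (H : Subgroup G) : cosetDegree H = (degree G : ℤ) - relDegree H := by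
  simp only [cosetDegree, degree, relDegree, mul_sub, Finset.sum_sub_distrib]
  push_cast
  rfl

theorem powerBounded_relGrowth (hF : Subgroup.closure F = ⊤) (hfin : F.Finite) (H : Subgroup G) :
    PowerBounded (relGrowth F H) (relDegree H) := by
  have hd : lcs G (1 + Group.nilpotencyClass G) = ⊥ := by
    rw [lcs, Subgroup.lowerCentralSeries_eq_bot_iff_nilpotencyClass_le]
    omega
  have hD : ∑ i ∈ Finset.Ico 1 (1 + Group.nilpotencyClass G), i * relRank H i = relDegree H := by
    rw [relDegree]
    congr 1
    ext i
    simp only [Finset.mem_Ico, Finset.mem_Icc]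
    omega
  obtain ⟨K, hK⟩ := exists_ncard_repSet_le hF hfin H le_rfl hd zero_le_one
  obtain ⟨C, hC, hC'⟩ := exists_le_ncard_repSet hF hfin H le_rfl hd
  obtain ⟨L, hL⟩ := exists_mem_wordBall_of_rep hF hfin le_rfl hC
  rw [hD] at hK hC'
  -- The constant `L` may be 0, so `L + 1` serves as the positive dilation factor.
  refine powerBounded_of_le (relGrowth_monotone hfin H) (K := K) (Nat.succ_pos L) (fun n hn => ?_)
    fun n hn => ?_
  · refine le_trans ?_ (hK n hn)
    rw [relGrowth_eq]
    refine Set.ncard_le_ncard ?_ (repSet_finite hF hfin H le_rfl hn 1)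
    rintro g ⟨hg, hgH⟩
    refine ⟨hgH, (rep_of_mem_wordBall hg n).mono (le_of_eq (mul_inv_cancel₀ ?_))⟩
    exact_mod_cast (show n ≠ 0 by omega)
  · refine (hC' n hn).trans ?_
    rw [relGrowth_eq]
    refine Set.ncard_le_ncard ?_ ((wordBall_finite hfin _).inter_of_left _)
    rintro g ⟨hgH, hg⟩
    exact ⟨wordBall_mono (Nat.mul_le_mul_right n (Nat.le_succ L)) (hL n hn g hg), hgH⟩

theorem powerBounded_cosetGrowth (hF : Subgroup.closure F = ⊤) (hfin : F.Finite)
    (H : Subgroup G) : PowerBounded (cosetGrowth F H) ((degree G : ℤ) - relDegree H) := by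
  rw [← relDegree_top]
  exact powerBounded_quotient (powerBounded_relGrowth hF hfin ⊤) (powerBounded_relGrowth hF hfin H)
    (relGrowth_top_le hfin H) (mul_cosetGrowth_le hfin H)

end Growth

end NilGrowth

theorem theoremE {G : Type*} [Group G] [Group.IsNilpotent G]
    (F : Finset G) (hF : Subgroup.closure (F : Set G) = ⊤) (H : Subgroup G) :
    NilGrowth.HasGrowthDegree (NilGrowth.relGrowth (F : Set G) H) (NilGrowth.relDegree H : ℝ) ∧
    NilGrowth.HasGrowthDegree (NilGrowth.cosetGrowth (F : Set G) H)
      (NilGrowth.cosetDegree H : ℝ) ∧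
    NilGrowth.cosetDegree H = (NilGrowth.degree G : ℤ) - NilGrowth.relDegree H ∧
    NilGrowth.Comparable (fun n => (NilGrowth.relGrowth (F : Set G) H n : ℝ))
      (fun n => (n : ℝ) ^ NilGrowth.relDegree H) ∧
    NilGrowth.Comparable (fun n => (NilGrowth.cosetGrowth (F : Set G) H n : ℝ))
      (fun n => (n : ℝ) ^ ((NilGrowth.degree G : ℤ) - NilGrowth.relDegree H)) := by
  have hfin := F.finite_toSet
  have hH := NilGrowth.powerBounded_relGrowth hF hfin H
  have hGH := NilGrowth.powerBounded_cosetGrowth hF hfin H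
  refine ⟨?_, ?_, NilGrowth.cosetDegree_eq H, ?_, hGH.comparable⟩
  · simpa using hH.hasGrowthDegree
  · rw [NilGrowth.cosetDegree_eq]
    exact hGH.hasGrowthDegree
  · simpa only [zpow_natCast] using hH.comparable
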